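/- Let $F$ be an algebraic function field (of one variable) with full constant field $\mathbb{F}_q$, let $n \ge 1$, let $P_1,\dots,P_n$ be distinct rational places of $F$, put $D = P_1+\cdots+P_n$, and let $G$ be a divisor of $F$ whose support contains none of the $P_i$. The associated AG code is $$\mathcal{C}_{\mathcal L}(D,G)=\{(f(P_1),\dots,f(P_n)) \mid f\in\mathcal L(G)\}\subseteq \mathbb{F}_q^n,\qquad \mathcal L(G)=\{f\in F\setminus\{0\} \mid (f)+G\ge 0\}\cup\{0\}.$$ Let $e \ge 1+\lceil \log_q n\rceil$ be an integer, let $F' = F\,\mathbb{F}_{q^e}$ be the constant field extension of $F$ of degree $e$, viewed as a function field over $\mathbb{F}_{q^e}$, and let $\mathrm{Con}$ denote the conorm of divisors from $F$ to $F'$. Then $\mathrm{Con}(P_i)=P_i'$ is a single rational place of $F'$ for every $i$, the places $P_1',\dots,P_n'$ are distinct and none of them lies in the support of $\mathrm{Con}(G)$; write again $D = P_1'+\cdots+P_n'$. Moreover, at least one of the following holds: 1. the code $\mathcal{C}_{\mathcal L}(D,G)$ over $\mathbb{F}_q$ is degenerate, i.e. there is an index $i$ such that $c_i=0$ for every codeword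 $c$; 2. there is an effective divisor $G'$ of $F'$ with $\deg G' = \deg G$, whose support contains none of the $P_i'$, such that the code $\mathcal{C}_{\mathcal L}(D,\mathrm{Con}(G))$ over $\mathbb{F}_{q^e}$ is monomially equivalent to $\mathcal{C}_{\mathcal L}(D,G')$ by means of column multipliers: there are nonzero $u_1,\dots,u_n\in\mathbb{F}_{q^e}$ with $\mathcal{C}_{\mathcal L}(D,G')=\{(u_1c_1,\dots,u_nc_n)\mid c\in \mathcal{C}_{\mathcal L}(D,\mathrm{Con}(G))\}$. -/

import Mathlib

noncomputable section

namespace AGCode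

universe u v

/-- A place of `F / k`, given by its valuation ring `O` with `k ⊆ O ⊊ F`. -/
@[ext]
structure Place (k : Type u) (F : Type v) [Field k] [Field F] [Algebra k F] where
  /-- The valuation ring `O_P`. -/
  ring : ValuationSubring F
  algebraMap_mem : ∀ a : k, algebraMap k F a ∈ ring
  ne_top : ring ≠ ⊤

namespace Place

variable {k : Type u} {F : Type v} [Field k] [Field F] [Algebra k F]

/-- `O_P` is a `k`-algebra; hence so is the residue field `O_P / P`. -/
instance (P : Place k F) : Algebra k P.ring :=
  ((algebraMap k F).codRestrict P.ring.toSubring P.algebraMap_mem).toAlgebra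

/-- The degree of a place: the degree of its residue field over `k`. -/
def degree (P : Place k F) : ℕ :=
  Module.finrank k (IsLocalRing.ResidueField P.ring)

/-- A rational place is a place of degree one. -/
def IsRational (P : Place k F) : Prop :=
  P.degree = 1

/-- `t` is a local parameter at `P`: the maximal ideal of `O_P` is `t O_P`. -/
def IsUniformizer (P : Place k F) (t : F) : Prop :=
  ∀ x : F, x ∈ P.ring.nonunits ↔ ∃ y ∈ P.ring, x = t * y

open Classical in
/-- The normalized discrete valuation `v_P(f) ∈ ℤ` of `f ≠ 0`: the integer `m` such that `f` is
a unit of `O_P` times `t ^ m`, where `t` is a local parameter. (It exists, and is unique, for every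
place of a function field and every `f ≠ 0`.) The value at `f = 0` is never used. -/
def ord (P : Place k F) (f : F) : ℤ :=
  if h : ∃ m : ℤ, ∃ t : F, P.IsUniformizer t ∧ P.ring.valuation f = P.ring.valuation t ^ m
  then h.choose else 0

open Classical in
/-- The value `f(P) ∈ k` of `f ∈ O_P` at a rational place `P`: the element `a` of `k` such that
`f - a` lies in the maximal ideal of `O_P`. -/
def value (P : Place k F) (f : F) : k :=
  if h : ∃ a : k, f - algebraMap k F a ∈ P.ring.nonunits then h.choose else 0

end Place

/-- Divisors of `F / k`: the free abelian group on the places. -/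
abbrev Divisor (k : Type u) (F : Type v) [Field k] [Field F] [Algebra k F] : Type v :=
  Place k F →₀ ℤ

section Codes

variable {k : Type u} {F : Type v} [Field k] [Field F] [Algebra k F]

/-- The degree of a divisor. -/
def Divisor.degree (A : Divisor k F) : ℤ :=
  A.sum fun P m => m * (P.degree : ℤ)

/-- The Riemann-Roch space `L(A) = {f ≠ 0 | (f) + A ≥ 0} ∪ {0}`. -/
def riemannRochSpace (A : Divisor k F) : Set F :=
  {f | f = 0 ∨ ∀ P : Place k F, 0 ≤ P.ord f + A P}

/-- The evaluation map `f ↦ (f(P_1), …, f(P_n))`. -/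
def evalAt {n : ℕ} (D : Fin n → Place k F) (f : F) : Fin n → k :=
  fun i => (D i).value f

/-- The algebraic geometry code `C_L(D, G)`, for `D = P_1 + ⋯ + P_n`. -/
def code {n : ℕ} (D : Fin n → Place k F) (G : Divisor k F) : Set (Fin n → k) :=
  evalAt D '' riemannRochSpace G

/-- A code is degenerate if some coordinate vanishes on all codewords. -/
def IsDegenerate {n : ℕ} (C : Set (Fin n → k)) : Prop :=
  ∃ i, ∀ c ∈ C, c i = 0

/-- Monomial equivalence by column multipliers: `C'` is the image of `C` under
`(c_1, …, c_n) ↦ (u_1 c_1, …, u_n c_n)` with all `u_i` nonzero. No permutation of the coordinates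
is allowed, so this implies the notion of monomial equivalence that permits one. -/
def IsMonomiallyEquivalent {n : ℕ} (C C' : Set (Fin n → k)) : Prop :=
  ∃ u : Fin n → kˣ, C' = (fun c i => (u i : k) * c i) '' C

end Codes

section Extension

universe w z

variable {k : Type u} {F : Type v} [Field k] [Field F] [Algebra k F]
variable {k' : Type w} {F' : Type z} [Field k'] [Field F'] [Algebra k' F'] [Algebra F F']

/-- `P' | P`: the place `P'` of `F'` lies over the place `P` of `F`, i.e. `O_P = O_P' ∩ F`. -/
def Place.LiesOver (P' : Place k' F') (P : Place k F) : Prop :=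
  P'.ring.comap (algebraMap F F') = P.ring

open Classical in
/-- The ramification index `e(P' | P)` of `P' | P`: the integer `e` with
`v_{P'}(x) = e * v_P(x)` for all nonzero `x` in `F`. -/
def ramificationIndex (P' : Place k' F') (P : Place k F) : ℕ :=
  if h : ∃ e : ℕ, ∀ x : F, x ≠ 0 → P'.ord (algebraMap F F' x) = (e : ℤ) * P.ord x
  then h.choose else 0

/-- The conorm of a single place, `∑_{P' | P} e(P' | P) P'` (a finite sum when `F' / F` is a
finite extension of function fields). -/
def conormPlace (k' : Type w) (F' : Type z) [Field k'] [Field F'] [Algebra k' F'] [Algebra F F']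
    (P : Place k F) : Divisor k' F' :=
  ∑ᶠ (P' : Place k' F') (_ : P'.LiesOver P), Finsupp.single P' (ramificationIndex P' P : ℤ)

/-- The conorm of a divisor of `F`, extended linearly from places. -/
def conorm (k' : Type w) (F' : Type z) [Field k'] [Field F'] [Algebra k' F'] [Algebra F F']
    (A : Divisor k F) : Divisor k' F' :=
  A.sum fun P m => m • conormPlace k' F' P

end Extension

end AGCode

end

/-!
A nondegenerate code `C_L(D, G)` has, for every `i`, a function `f_i ∈ L(G)` that does not vanish at
`P_i`. Over a constant field with more than `n` elements some linear combination `f` of the `f_i`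
vanishes at none of the places above the `P_i` (`exists_mem_forall_ne_zero`), and
`|k'| = q ^ e > n`. Then `G' = Con(G) + (f)` is effective because `f ∈ L(Con G)`, it is supported
away from the `P_i'`, and `L(G') = f⁻¹ L(Con G)`, so that its code arises from that of `Con(G)` by
the column multipliers `f(P_i')⁻¹` (`exists_effective_of_forall_value_ne_zero`). It remains to know
that `deg (f) = 0`, that `deg Con(G) = deg G`, and that `Con(P_i)` is a single rational place.

All three come from one identity (`exists_finset_sum_ord_mul_degree`): if `R ⊇ k` is a domain in `F`
whose integral closure `S` in `F` is a finite flat `R`-module and a Dedekind domain with fraction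
field `F`, and `t` generates a maximal ideal of `R`, then the places of `F / k` that contain `R` and
at which `t` vanishes satisfy `∑ v_P(t) deg P = rank_R S · dim_k (R / t)`. These places
correspond to the primes of `S` above `t`, and the sum is `∑ e f` over these primes.

* With `R = k[f]` and `t = f`, the number of zeros of `f` is `[F : k(f)]`. As `k(f) = k(f⁻¹)`, it is
  also the number of poles (`IsFunctionFieldLE.exists_principal_divisor`). The element `f` need not
  be separating; finiteness of the integral closure then follows since `k` is perfect
  (`finite_integralClosure_of_finite_iterateFrobenius`).
* With `R = O_P` and `t` a local parameter, the places of `F'` above `P` satisfy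
  `∑ e(P' | P) [k' : k] deg P' = [F' : F] deg P`, and `[F' : F] = [k' : k]` because `k` is
  algebraically closed in `F` (`isSeparable_and_finrank_of_adjoin_eq_top`). Hence the conorm
  preserves degrees, and above a rational place the sum `∑ e(P' | P) deg P' = 1` has a single term.
-/

noncomputable section

namespace AGCode

open WithZero IsDedekindDomain Module

/-! ### Discrete places and the order function -/

/-- `w` is the normalized discrete valuation of the place `P`, written multiplicatively: its
valuation ring is `O_P`, and it takes the value `exp (-1)`. -/
def Place.IsNormalized {k F : Type*} [Field k] [Field F] [Algebra k F] (P : Place k F)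
    (w : Valuation F ℤᵐ⁰) : Prop :=
  w.valuationSubring = P.ring ∧ ∃ π, w π = exp (-1)

/-- A place is discrete if its valuation ring is that of a normalized `ℤᵐ⁰`-valued valuation. -/
def Place.IsDiscrete {k F : Type*} [Field k] [Field F] [Algebra k F] (P : Place k F) : Prop :=
  ∃ w : Valuation F ℤᵐ⁰, P.IsNormalized w

theorem lt_one_iff_le_exp_neg_one {x : ℤᵐ⁰} : x < 1 ↔ x ≤ exp (-1) := by
  by_cases hx : x = 0
  · simp [hx]
  · rw [← exp_log hx, ← exp_zero, exp_lt_exp, exp_le_exp]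
    omega

namespace Place

variable {k F : Type*} [Field k] [Field F] [Algebra k F] {P : Place k F} {w : Valuation F ℤᵐ⁰}

theorem IsNormalized.isEquiv (h : P.IsNormalized w) : w.IsEquiv P.ring.valuation :=
  h.1 ▸ w.isEquiv_valuation_valuationSubring

theorem IsNormalized.mem_iff (h : P.IsNormalized w) {x : F} : x ∈ P.ring ↔ w x ≤ 1 := by
  rw [← h.1, Valuation.mem_valuationSubring_iff]

theorem IsNormalized.mem_nonunits_iff (h : P.IsNormalized w) {x : F} :
    x ∈ P.ring.nonunits ↔ w x < 1 := by
  rw [ValuationSubring.mem_nonunits_iff, h.isEquiv.lt_one_iff_lt_one]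

theorem IsNormalized.isUniformizer_iff (h : P.IsNormalized w) {t : F} :
    P.IsUniformizer t ↔ w t = exp (-1) := by
  simp only [IsUniformizer, h.mem_iff, h.mem_nonunits_iff]
  constructor
  · intro H
    obtain ⟨π, hπ⟩ := h.2
    obtain ⟨y, hy, rfl⟩ := (H π).1 (by rw [hπ, ← exp_zero, exp_lt_exp]; omega)
    refine le_antisymm (lt_one_iff_le_exp_neg_one.1 ((H t).2 ⟨1, by simp⟩)) ?_
    rw [← hπ, map_mul]
    exact mul_le_of_le_one_right' hy
  · intro ht x
    have ht0 : t ≠ 0 := by rintro rfl; exact exp_ne_zero (ht.symm.trans (map_zero w))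
    constructor
    · intro hx
      refine ⟨t⁻¹ * x, ?_, by field_simp⟩
      rw [map_mul, map_inv₀, ht]
      calc (exp (-1) : ℤᵐ⁰)⁻¹ * w x ≤ (exp (-1) : ℤᵐ⁰)⁻¹ * exp (-1) :=
            mul_le_mul_right (lt_one_iff_le_exp_neg_one.1 hx) _
        _ = 1 := inv_mul_cancel₀ exp_ne_zero
    · rintro ⟨y, hy, rfl⟩
      rw [map_mul, ht, lt_one_iff_le_exp_neg_one]
      exact mul_le_of_le_one_right' hy

/-- The order function is minus the logarithm of any normalized valuation of the place. -/
theorem IsNormalized.eq_exp_neg_ord (h : P.IsNormalized w) {f : F} (hf : f ≠ 0) :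
    w f = exp (-P.ord f) := by
  have key : ∀ m t, P.IsUniformizer t →
      (P.ring.valuation f = P.ring.valuation t ^ m ↔ w f = exp (-m)) := by
    intro m t ht
    rw [h.isUniformizer_iff] at ht
    rw [← map_zpow₀, ← h.isEquiv.eq_iff, map_zpow₀, ht, ← exp_zsmul]
    simp
  have hex : ∃ m : ℤ, ∃ t : F, P.IsUniformizer t ∧
      P.ring.valuation f = P.ring.valuation t ^ m := by
    obtain ⟨π, hπ⟩ := h.2
    have hπ' := h.isUniformizer_iff.2 hπ
    refine ⟨-log (w f), π, hπ', (key _ _ hπ').2 ?_⟩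
    rw [neg_neg, exp_log (by simpa using hf)]
  rw [ord, dif_pos hex]
  obtain ⟨t, ht, h'⟩ := hex.choose_spec
  exact (key _ _ ht).1 h'

namespace IsDiscrete

theorem ord_mul (h : P.IsDiscrete) {f g : F} (hf : f ≠ 0) (hg : g ≠ 0) :
    P.ord (f * g) = P.ord f + P.ord g := by
  obtain ⟨w, h⟩ := h
  have := map_mul w f g
  rw [h.eq_exp_neg_ord hf, h.eq_exp_neg_ord hg, h.eq_exp_neg_ord (mul_ne_zero hf hg), ← exp_add,
    exp_inj] at this
  omega

theorem ord_inv (h : P.IsDiscrete) {f : F} (hf : f ≠ 0) : P.ord f⁻¹ = -P.ord f := by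
  obtain ⟨w, h⟩ := h
  have := map_inv₀ w f
  rw [h.eq_exp_neg_ord hf, h.eq_exp_neg_ord (inv_ne_zero hf), ← exp_neg, exp_inj] at this
  omega

theorem ord_nonneg_iff (h : P.IsDiscrete) {f : F} (hf : f ≠ 0) : 0 ≤ P.ord f ↔ f ∈ P.ring := by
  obtain ⟨w, h⟩ := h
  rw [h.mem_iff, h.eq_exp_neg_ord hf, ← exp_zero, exp_le_exp, neg_nonpos]

theorem ord_pos_iff (h : P.IsDiscrete) {f : F} (hf : f ≠ 0) :
    0 < P.ord f ↔ f ∈ P.ring.nonunits := by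
  obtain ⟨w, h⟩ := h
  rw [h.mem_nonunits_iff, h.eq_exp_neg_ord hf, ← exp_zero, exp_lt_exp, neg_lt_zero]

theorem le_ord_add (h : P.IsDiscrete) {f g : F} (hf : f ≠ 0) (hg : g ≠ 0) (hfg : f + g ≠ 0)
    {m : ℤ} (hmf : m ≤ P.ord f) (hmg : m ≤ P.ord g) : m ≤ P.ord (f + g) := by
  obtain ⟨w, h⟩ := h
  have := w.map_add_le (g := exp (-m)) (x := f) (y := g)
    (by rw [h.eq_exp_neg_ord hf, exp_le_exp]; omega)
    (by rw [h.eq_exp_neg_ord hg, exp_le_exp]; omega)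
  rw [h.eq_exp_neg_ord hfg, exp_le_exp] at this
  omega

theorem exists_ord_eq_one (h : P.IsDiscrete) : ∃ t : F, t ≠ 0 ∧ P.ord t = 1 := by
  obtain ⟨w, h⟩ := h
  obtain ⟨π, hπ⟩ := h.2
  have hπ0 : π ≠ 0 := by rintro rfl; exact exp_ne_zero (hπ.symm.trans (map_zero w))
  refine ⟨π, hπ0, ?_⟩
  rw [h.eq_exp_neg_ord hπ0, exp_inj] at hπ
  omega

theorem ord_algebraMap (h : P.IsDiscrete) {a : k} (ha : a ≠ 0) : P.ord (algebraMap k F a) = 0 := by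
  have h0 : algebraMap k F a ≠ 0 := by simpa using ha
  have h1 := (h.ord_nonneg_iff h0).2 (P.algebraMap_mem a)
  have h2 := (h.ord_nonneg_iff (inv_ne_zero h0)).2
    (by rw [← map_inv₀]; exact P.algebraMap_mem a⁻¹)
  rw [h.ord_inv h0] at h2
  omega

end IsDiscrete

end Place

/-! ### Valuation rings containing a Dedekind domain -/

section Dedekind

variable {S F : Type*} [CommRing S] [IsDedekindDomain S] [Field F] [Algebra S F]
  [IsFractionRing S F]

theorem algebraMap_mem_valuationSubring (v : HeightOneSpectrum S) (s : S) :
    algebraMap S F s ∈ (v.valuation F).valuationSubring :=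
  (Valuation.mem_valuationSubring_iff _ _).2 (v.valuation_le_one s)

/-- A proper valuation ring of `Frac S` that contains the Dedekind domain `S` is the localization
of `S` at the centre of the valuation. -/
theorem exists_eq_valuationSubring (O : ValuationSubring F) (hO : ∀ s : S, algebraMap S F s ∈ O)
    (htop : O ≠ ⊤) :
    ∃ v : HeightOneSpectrum S, O = (v.valuation F).valuationSubring := by
  let φ : S →+* O := (algebraMap S F).codRestrict O.toSubring hO
  let p : Ideal S := (IsLocalRing.maximalIdeal O).comap φ
  have hp : p.IsPrime := Ideal.IsPrime.comap φ
  have hunit : ∀ s : S, s ∉ p → (algebraMap S F s)⁻¹ ∈ O := by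
    intro s hs
    by_contra h
    exact hs (ValuationSubring.coe_mem_nonunits_iff.1
      (show ((φ s : O) : F) ∈ O.nonunits from
        (ValuationSubring.mem_nonunits_iff_or O).2 (Or.inr h)))
  have hne : p ≠ ⊥ := by
    intro hbot
    refine htop (eq_top_iff.2 fun x _ => ?_)
    obtain ⟨a, b, hb, rfl⟩ := IsFractionRing.div_surjective (A := S) x
    rw [div_eq_mul_inv]
    refine O.mul_mem _ _ (hO a) (hunit b ?_)
    rw [hbot]
    exact nonZeroDivisors.ne_zero hb
  refine ⟨⟨p, hp, hne⟩, (ValuationSubring.eq_of_le_of_ne_top _ ?_ htop).symm⟩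
  intro x hx
  obtain ⟨n, d, hnd⟩ := HeightOneSpectrum.exists_primeCompl_mul_eq_of_integer _ x
    ((Valuation.mem_valuationSubring_iff _ _).1 hx)
  have hd0 : algebraMap S F d ≠ 0 := by
    intro h0
    rw [FaithfulSMul.algebraMap_eq_zero_iff] at h0
    exact d.2 (by rw [h0]; exact Ideal.zero_mem _)
  rw [(eq_mul_inv_iff_mul_eq₀ hd0).2 hnd]
  exact O.mul_mem _ _ (hO n) (hunit d d.2)

theorem valuationSubring_ne_top (v : HeightOneSpectrum S) :
    (v.valuation F).valuationSubring ≠ ⊤ := by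
  obtain ⟨π, hπ⟩ := v.valuation_exists_uniformizer F
  intro h
  have hmem : π⁻¹ ∈ (v.valuation F).valuationSubring := h ▸ ValuationSubring.mem_top _
  rw [Valuation.mem_valuationSubring_iff, map_inv₀, hπ, ← exp_neg, ← exp_zero, exp_le_exp] at hmem
  omega

theorem mem_nonunits_valuationSubring_iff (v : HeightOneSpectrum S) (x : F) :
    x ∈ ((v.valuation F).valuationSubring).nonunits ↔ v.valuation F x < 1 := by
  rw [ValuationSubring.mem_nonunits_iff,
    (v.valuation F).isEquiv_valuation_valuationSubring.lt_one_iff_lt_one]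

theorem isNormalized_of_ring_eq {k : Type*} [Field k] [Algebra k F] {P : Place k F}
    {v : HeightOneSpectrum S} (h : P.ring = (v.valuation F).valuationSubring) :
    P.IsNormalized (v.valuation F) :=
  ⟨h.symm, v.valuation_exists_uniformizer F⟩

/-- The residue field of the place given by a prime `v` of the Dedekind domain `S` is `S / v`. -/
theorem degree_eq_finrank_quotient {k : Type*} [Field k] [Algebra k F] [Algebra k S]
    [IsScalarTower k S F] {P : Place k F}
    {v : HeightOneSpectrum S} (h : P.ring = (v.valuation F).valuationSubring) :
    P.degree = finrank k (S ⧸ v.asIdeal) := by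
  have hN := isNormalized_of_ring_eq h
  have hmem : ∀ s : S, algebraMap S F s ∈ P.ring := fun s =>
    h ▸ algebraMap_mem_valuationSubring v s
  let φ : S →ₐ[k] P.ring :=
    { (algebraMap S F).codRestrict P.ring.toSubring hmem with
      commutes' := fun a => Subtype.ext (IsScalarTower.algebraMap_apply k S F a).symm }
  let ψ : S →ₐ[k] IsLocalRing.ResidueField P.ring :=
    (IsScalarTower.toAlgHom k P.ring (IsLocalRing.ResidueField P.ring)).comp φ
  have hψ0 : ∀ x : P.ring, IsLocalRing.residue P.ring x = 0 ↔ v.valuation F (x : F) < 1 := by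
    intro x
    rw [IsLocalRing.residue_eq_zero_iff, ← ValuationSubring.coe_mem_nonunits_iff,
      hN.mem_nonunits_iff]
  have hker : ∀ s, ψ s = 0 ↔ s ∈ v.asIdeal := by
    intro s
    rw [← v.valuation_lt_one_iff_mem (K := F)]
    exact hψ0 (φ s)
  have hsurj : Function.Surjective ψ := by
    intro y
    obtain ⟨x, rfl⟩ := IsLocalRing.residue_surjective y
    obtain ⟨a, ha⟩ := v.exists_valuation_sub_lt_of_integer (hN.mem_iff.1 x.2) 1
    refine ⟨a, ?_⟩
    have : IsLocalRing.residue P.ring (φ a - x) = 0 := (hψ0 _).2 ha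
    rw [map_sub, sub_eq_zero] at this
    exact this
  have hk : RingHom.ker ψ = v.asIdeal := Ideal.ext hker
  rw [Place.degree, ← hk]
  exact (Ideal.quotientKerAlgEquivOfSurjective hsurj).toLinearEquiv.finrank_eq.symm

end Dedekind

/-! ### The fundamental identity in terms of places -/

section FundamentalIdentity

/-- The place of `F = Frac S` given by a nonzero prime of the Dedekind domain `S ⊇ k`. -/
def placeOfPrime (k F : Type*) {S : Type*} [Field k] [CommRing S] [IsDedekindDomain S] [Field F]
    [Algebra S F] [IsFractionRing S F] [Algebra k F] [Algebra k S] [IsScalarTower k S F]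
    (v : HeightOneSpectrum S) : Place k F where
  ring := (v.valuation F).valuationSubring
  algebraMap_mem a := by
    rw [IsScalarTower.algebraMap_apply k S F]
    exact algebraMap_mem_valuationSubring v _
  ne_top := valuationSubring_ne_top v

theorem mem_valuationSubring_of_isIntegral {R F : Type*} [CommRing R] [Field F] [Algebra R F]
    (O : ValuationSubring F) (hR : ∀ r : R, algebraMap R F r ∈ O) {x : F} (hx : IsIntegral R x) :
    x ∈ O := by
  obtain ⟨p, hp, hpx⟩ := hx
  let φ : R →+* O := (algebraMap R F).codRestrict O.toSubring hR
  have : IsIntegral O x := by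
    refine ⟨p.map φ, hp.map φ, ?_⟩
    rw [Polynomial.eval₂_map]
    exact hpx
  obtain ⟨y, rfl⟩ := (IsIntegrallyClosed.isIntegral_iff (R := O) (K := F)).1 this
  exact y.2

/-- The places `P` of `F ⊇ R` that are centred at the prime element `t` of `R` are finite in
number, have finite degree and satisfy `∑ v_P(t) deg P = [F : Frac R] · deg (R / t)`. -/
theorem exists_finset_sum_ord_mul_degree {k F R : Type*} [Field k] [Field F] [CommRing R]
    [IsDomain R] [Algebra k F] [Algebra k R] [Algebra R F]
    (S : Type*) [CommRing S]
    [IsDedekindDomain S] [Algebra k S] [Algebra R S] [Algebra S F] [IsScalarTower k S F]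
    [IsScalarTower k R S] [IsScalarTower R S F] [IsFractionRing S F] [Module.Finite R S]
    [Module.Flat R S] [Module.IsTorsionFree R S] {t : R} (ht : t ≠ 0)
    (hmax : (Ideal.span {t}).IsMaximal) [FiniteDimensional k (R ⧸ Ideal.span {t})] :
    ∃ s : Finset (Place k F),
      (∀ P, P ∈ s ↔ (∀ r : R, algebraMap R F r ∈ P.ring) ∧
        algebraMap R F t ∈ P.ring.nonunits) ∧
      (∀ P ∈ s, P.IsDiscrete ∧ 0 < P.degree) ∧
      ∑ P ∈ s, P.ord (algebraMap R F t) * (P.degree : ℤ) =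
        (finrank R S * finrank k (R ⧸ Ideal.span {t}) : ℕ) := by
  classical
  set p : Ideal R := Ideal.span {t} with hp
  have ht' : algebraMap R S t ≠ 0 := by
    rwa [Ne, FaithfulSMul.algebraMap_eq_zero_iff]
  have hF : algebraMap R F t ≠ 0 := by
    rw [IsScalarTower.algebraMap_apply R S F, Ne, FaithfulSMul.algebraMap_eq_zero_iff]
    exact ht'
  have hpbot : p ≠ ⊥ := by simpa [hp] using ht
  have hmap : p.map (algebraMap R S) = Ideal.span {algebraMap R S t} := by
    rw [hp, Ideal.map_span, Set.image_singleton]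
  have hmapbot : p.map (algebraMap R S) ≠ ⊥ := by
    rw [hmap]; simpa using ht'
  let := Fintype.ofFinite (p.primesOver S)
  let V : p.primesOver S → HeightOneSpectrum S := fun q =>
    ⟨q.1, q.2.1, by
      have := q.2.2
      exact ne_bot_of_le_ne_bot hmapbot (Ideal.map_le_of_le_comap (q.1.over_def p).le)⟩
  let Φ : p.primesOver S ↪ Place k F :=
    ⟨fun q => placeOfPrime k F (V q), by
      intro q q' h
      have h1 : (placeOfPrime k F (V q)).ring = (placeOfPrime k F (V q')).ring := by
        exact congrArg Place.ring h
      have := HeightOneSpectrum.eq_of_valuation_isEquiv_valuation (K := F) (p := V q) (q := V q')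
        ((Valuation.isEquiv_iff_valuationSubring _ _).2 h1)
      exact Subtype.ext (congrArg HeightOneSpectrum.asIdeal this)⟩
  have hval : ∀ q, (V q).valuation F (algebraMap R F t) =
      exp (-(q.1.ramificationIdx R : ℤ)) := by
    intro q
    have := q.2.1
    have := q.2.2
    rw [Ideal.IsDedekindDomain.ramificationIdx_eq_multiplicity p q.1 hmapbot, hmap,
      IsScalarTower.algebraMap_apply R S F, HeightOneSpectrum.valuation_of_algebraMap,
      HeightOneSpectrum.intValuation_eq_exp_neg_multiplicity _ ht']
  have hord : ∀ q, (Φ q).ord (algebraMap R F t) = q.1.ramificationIdx R := by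
    intro q
    have h1 := (isNormalized_of_ring_eq (P := Φ q) (v := V q) rfl).eq_exp_neg_ord hF
    rw [hval, exp_inj] at h1
    omega
  have hdeg : ∀ q, (Φ q).degree = finrank k (R ⧸ p) * q.1.inertiaDeg R := by
    intro q
    have := q.2.1
    have hover := q.2.2
    have : q.1.IsMaximal := (V q).isMaximal
    rw [degree_eq_finrank_quotient (P := Φ q) (v := V q) rfl, Ideal.inertiaDeg_eq_of_isMaximal p]
    let := Ideal.Quotient.field p
    have : IsScalarTower k (R ⧸ p) (S ⧸ q.1) := by
      refine IsScalarTower.of_algebraMap_eq fun a => ?_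
      rw [IsScalarTower.algebraMap_apply k S (S ⧸ q.1), IsScalarTower.algebraMap_apply k R S,
        IsScalarTower.algebraMap_apply k R (R ⧸ p)]
      rfl
    exact (finrank_mul_finrank k (R ⧸ p) (S ⧸ q.1)).symm
  refine ⟨Finset.univ.map Φ, ?_, ?_, ?_⟩
  · intro P
    simp only [Finset.mem_map, Finset.mem_univ, true_and]
    constructor
    · rintro ⟨q, rfl⟩
      constructor
      · intro r
        rw [IsScalarTower.algebraMap_apply R S F]
        exact algebraMap_mem_valuationSubring (V q) _
      · refine (mem_nonunits_valuationSubring_iff (V q) _).2 ?_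
        have := q.2.1
        rw [hval, ← exp_zero, exp_lt_exp]
        have := Ideal.ramificationIdx_pos q.1 R
        omega
    · rintro ⟨hR, htP⟩
      obtain ⟨v, hv⟩ := exists_eq_valuationSubring (S := S) P.ring (fun s =>
        mem_valuationSubring_of_isIntegral P.ring hR
          ((Algebra.IsIntegral.isIntegral (R := R) s).algebraMap)) P.ne_top
      have htv : t ∈ v.asIdeal.comap (algebraMap R S) := by
        rw [hv, mem_nonunits_valuationSubring_iff, IsScalarTower.algebraMap_apply R S F,
          HeightOneSpectrum.valuation_lt_one_iff_mem] at htP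
        exact htP
      have hover : v.asIdeal.LiesOver p := by
        refine ⟨hmax.eq_of_le (Ideal.IsPrime.ne_top (Ideal.IsPrime.comap _)) ?_⟩
        rwa [hp, Ideal.span_singleton_le_iff_mem]
      exact ⟨⟨v.asIdeal, v.isPrime, hover⟩, Place.ext hv.symm⟩
  · intro P hP
    obtain ⟨q, -, rfl⟩ := Finset.mem_map.1 hP
    have := q.2.1
    refine ⟨⟨_, isNormalized_of_ring_eq (v := V q) rfl⟩, ?_⟩
    rw [hdeg]
    exact Nat.mul_pos finrank_pos (Ideal.inertiaDeg_pos q.1 R)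
  · rw [Finset.sum_map, ← Ideal.sum_ramification_inertia_eq_finrank p S, Finset.sum_mul]
    push_cast
    refine Finset.sum_congr rfl fun q _ => ?_
    rw [hord, hdeg]
    push_cast
    ring

end FundamentalIdentity

/-! ### Finiteness of integral closures -/

section Finiteness

theorem finite_of_comp_finite_of_injective {A B C : Type*} [CommRing A] [CommRing B] [CommRing C]
    [IsNoetherianRing A] (f : A →+* B) (g : B →+* C) (hg : Function.Injective g)
    (h : (g.comp f).Finite) : f.Finite := by
  algebraize [f, g, g.comp f]
  exact Module.Finite.of_injective (IsScalarTower.toAlgHom A B C).toLinearMap hg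

/-- The iterated Frobenius of a finitely generated algebra over a perfect ring is finite. -/
theorem finite_iterateFrobenius {k R : Type*} [CommRing k] [CommRing R] [Algebra k R]
    [Algebra.FiniteType k R] (p : ℕ) [ExpChar k p] [ExpChar R p] [PerfectRing k p] (n : ℕ) :
    (iterateFrobenius R p n).Finite := by
  refine RingHom.IsIntegral.to_finite (fun x => ?_) ?_
  · refine ⟨Polynomial.X ^ p ^ n - Polynomial.C x,
      Polynomial.monic_X_pow_sub_C _ (expChar_pow_pos R p n).ne', ?_⟩
    simp [iterateFrobenius_def]
  · refine RingHom.FiniteType.of_comp_finiteType (f := algebraMap k R) ?_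
    have : (iterateFrobenius R p n).comp (algebraMap k R) =
        (algebraMap k R).comp (iterateFrobenius k p n) := by
      ext x
      simp [iterateFrobenius_def]
    rw [this]
    refine RingHom.FiniteType.comp ?_ (RingHom.FiniteType.of_surjective _ ?_)
    · exact RingHom.finiteType_algebraMap.2 inferInstance
    · exact (bijective_iterateFrobenius k p n).surjective

/-- The integral closure of an integrally closed Noetherian domain with finite Frobenius in a
finite field extension is finite. With `E` the separable closure of `K` in `F`, some power of
Frobenius maps `F` into `E`, where the integral closure is finite; this power of Frobenius makes
the integral closure in `F` a submodule of a finite module. -/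
theorem finite_integralClosure_of_finite_iterateFrobenius {R : Type*} (K : Type*) {F : Type*}
    [CommRing R] [IsDomain R] [IsNoetherianRing R] [IsIntegrallyClosed R] [Field K] [Field F]
    [Algebra R K] [IsFractionRing R K] [Algebra R F] [Algebra K F] [IsScalarTower R K F]
    [FiniteDimensional K F] (p : ℕ) [ExpChar R p] (hR : ∀ n, (iterateFrobenius R p n).Finite) :
    Module.Finite R (integralClosure R F) := by
  have : ExpChar K p := expChar_of_injective_algebraMap (IsFractionRing.injective R K) p
  let E := separableClosure K F
  have : ExpChar E p := expChar_of_injective_algebraMap (algebraMap K E).injective p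
  have : IsScalarTower R E F := .of_algebraMap_eq fun _ => rfl
  let n := IsPurelyInseparable.exponent E F
  let φ : F →+* E := IsPurelyInseparable.iterateFrobenius E F p (n := n) le_rfl
  have hφ : ∀ x, algebraMap E F (φ x) = x ^ p ^ n :=
    IsPurelyInseparable.algebraMap_iterateFrobenius E p le_rfl
  let C := integralClosure R E
  have hC : Module.Finite R C := IsIntegralClosure.finite R K E C
  have hmem : ∀ x : integralClosure R F, φ x ∈ C := by
    intro x
    have h1 : IsIntegral R (algebraMap E F (φ x)) := by
      rw [hφ]
      exact x.2.pow _
    exact (isIntegral_algebraMap_iff (algebraMap E F).injective).1 h1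
  let g : integralClosure R F →+* C :=
    (φ.comp (integralClosure R F).subtype).codRestrict C.toSubring hmem
  have hg : Function.Injective g := by
    intro x y hxy
    exact Subtype.ext (φ.injective (congrArg Subtype.val hxy))
  have hcomp : g.comp (algebraMap R (integralClosure R F)) =
      (algebraMap R C).comp (iterateFrobenius R p n) := by
    refine RingHom.ext fun r => Subtype.ext ((algebraMap E F).injective ?_)
    change algebraMap E F (φ (algebraMap R F r)) =
      algebraMap E F (algebraMap R E (iterateFrobenius R p n r))
    rw [hφ, iterateFrobenius_def, map_pow, map_pow, ← IsScalarTower.algebraMap_apply]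
  have hfin : (algebraMap R (integralClosure R F)).Finite := by
    refine finite_of_comp_finite_of_injective _ g hg ?_
    rw [hcomp]
    exact RingHom.Finite.comp (RingHom.finite_algebraMap.2 hC) (hR n)
  exact RingHom.finite_algebraMap.1 hfin

/-- Finiteness of the integral closure replaces separability in the usual proof that it is a
Dedekind domain. -/
theorem isDedekindDomain_integralClosure_of_finite (R K F : Type*)
    [CommRing R] [IsDedekindDomain R] [Field K] [Field F]
    [Algebra R K] [IsFractionRing R K] [Algebra R F] [Algebra K F] [IsScalarTower R K F]
    [FiniteDimensional K F] [Module.Finite R (integralClosure R F)] :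
    IsDedekindDomain (integralClosure R F) :=
  have := IsIntegralClosure.isFractionRing_of_finite_extension R K F (integralClosure R F)
  { isNoetherianRing_iff.mpr <| isNoetherian_of_tower R inferInstance,
    Ring.DimensionLEOne.of_isIntegral R (integralClosure R F),
    (isIntegrallyClosed_iff F).mpr fun {x} hx =>
      ⟨IsIntegralClosure.mk' (integralClosure R F) x (isIntegral_trans (R := R) _ hx),
        IsIntegralClosure.algebraMap_mk' _ _ _⟩ with }

/-- The fundamental identity over a principal ideal domain `R ⊇ k` with finite integral closure. -/
theorem exists_finset_sum_ord_mul_degree_of_finite {k R : Type*} (K : Type*) {F : Type*} [Field k]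
    [CommRing R] [IsDomain R] [IsPrincipalIdealRing R] [Field K] [Field F]
    [Algebra k R] [Algebra k F] [Algebra R K] [IsFractionRing R K] [Algebra R F] [Algebra K F]
    [IsScalarTower R K F] [IsScalarTower k R F]
    [FiniteDimensional K F] [Module.Finite R (integralClosure R F)] {t : R} (ht : t ≠ 0)
    (hmax : (Ideal.span {t}).IsMaximal) [FiniteDimensional k (R ⧸ Ideal.span {t})] :
    ∃ s : Finset (Place k F),
      (∀ P, P ∈ s ↔ (∀ r : R, algebraMap R F r ∈ P.ring) ∧
        algebraMap R F t ∈ P.ring.nonunits) ∧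
      (∀ P ∈ s, P.IsDiscrete ∧ 0 < P.degree) ∧
      ∑ P ∈ s, P.ord (algebraMap R F t) * (P.degree : ℤ) =
        (finrank K F * finrank k (R ⧸ Ideal.span {t}) : ℕ) := by
  have := isDedekindDomain_integralClosure_of_finite R K F
  have := IsIntegralClosure.isFractionRing_of_finite_extension R K F (integralClosure R F)
  have : FaithfulSMul R F := by
    rw [faithfulSMul_iff_algebraMap_injective, IsScalarTower.algebraMap_eq R K F]
    exact (algebraMap K F).injective.comp (IsFractionRing.injective R K)
  rw [IsFractionRing.finrank_eq R K (integralClosure R F) F]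
  exact exists_finset_sum_ord_mul_degree (integralClosure R F) ht hmax

end Finiteness

/-! ### Function fields and principal divisors -/

section FunctionField

open scoped IntermediateField

/-- `F / k` is finitely generated of transcendence degree at most one. This encoding singles out no
subfield `k(x)`, and passes to finite extensions of `F` and to algebraic extensions of `k`. The
algebraic case is harmless: then `F / k` has no places. -/
structure IsFunctionFieldLE (k F : Type*) [Field k] [Field F] [Algebra k F] : Prop where
  essFiniteType : Algebra.EssFiniteType k F
  trdeg_le_one : Algebra.trdeg k F ≤ 1

theorem IsFunctionFieldLE.of_functionField (k F : Type*) [Field k] [Field F] [Algebra k F]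
    [Algebra (RatFunc k) F] [IsScalarTower k (RatFunc k) F] [FunctionField k F] :
    IsFunctionFieldLE k F where
  essFiniteType :=
    have : Algebra.EssFiniteType (Polynomial k) (RatFunc k) :=
      .of_isLocalization _ (nonZeroDivisors (Polynomial k))
    have : Algebra.EssFiniteType k (RatFunc k) := .comp k (Polynomial k) (RatFunc k)
    have : FiniteDimensional (RatFunc k) F := inferInstance
    .comp k (RatFunc k) F
  trdeg_le_one := by
    have : FiniteDimensional (RatFunc k) F := inferInstance
    have h1 := trdeg_add_eq k (Polynomial k) (A := RatFunc k)
    have : Algebra.IsAlgebraic (Polynomial k) (RatFunc k) :=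
      IsLocalization.isAlgebraic _ (nonZeroDivisors (Polynomial k))
    have h2 := lift_trdeg_add_eq k (RatFunc k) F
    rw [trdeg_eq_zero (R := RatFunc k) (A := F), Cardinal.lift_zero, add_zero, ← h1,
      trdeg_eq_zero (R := Polynomial k), Polynomial.trdeg_of_isDomain, add_zero,
      Cardinal.lift_one] at h2
    rw [← Cardinal.lift_le_one_iff, ← h2]

theorem IsFunctionFieldLE.of_finite {k F F' : Type*} [Field k] [Field F] [Algebra k F]
    [Field F'] [Algebra k F'] [Algebra F F'] [IsScalarTower k F F'] [FiniteDimensional F F']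
    (h : IsFunctionFieldLE k F) : IsFunctionFieldLE k F' where
  essFiniteType :=
    have := h.1
    .comp k F F'
  trdeg_le_one := by
    have h2 := lift_trdeg_add_eq k F F'
    rw [trdeg_eq_zero (R := F), Cardinal.lift_zero, add_zero] at h2
    rw [← Cardinal.lift_le_one_iff, ← h2, Cardinal.lift_le_one_iff]
    exact h.2

theorem IsFunctionFieldLE.extendScalars {k k' F : Type*} [Field k] [Field k'] [Algebra k k']
    [Field F] [Algebra k F] [Algebra k' F] [IsScalarTower k k' F] [Algebra.IsAlgebraic k k']
    (h : IsFunctionFieldLE k F) : IsFunctionFieldLE k' F where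
  essFiniteType :=
    have := h.1
    .of_comp k k' F
  trdeg_le_one := by
    have h2 := lift_trdeg_add_eq k k' F
    rw [trdeg_eq_zero, Cardinal.lift_zero, zero_add] at h2
    rw [← Cardinal.lift_le_one_iff, h2, Cardinal.lift_le_one_iff]
    exact h.2

/-- A function field is finite over `k(f)` for every transcendental `f`, separable or not. -/
theorem IsFunctionFieldLE.finiteDimensional {k F : Type*} [Field k] [Field F] [Algebra k F]
    (h : IsFunctionFieldLE k F) {f : F} (hf : Transcendental k f) :
    FiniteDimensional k⟮f⟯ F := by
  have := h.1
  have hb : IsTranscendenceBasis k (fun _ : Unit => f) :=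
    AlgebraicIndependent.isTranscendenceBasis_of_lift_trdeg_le_of_finite
      ((algebraicIndependent_unique_type_iff).2 hf) (by simpa using h.2)
  have halg := hb.isAlgebraic_field
  rw [Set.range_const] at halg
  have : Algebra.EssFiniteType k⟮f⟯ F := .of_comp k k⟮f⟯ F
  exact Algebra.finite_of_essFiniteType_of_isAlgebraic

variable {k F : Type*} [Field k] [Field F] [Algebra k F]

/-- The subalgebra generated by a transcendental element is a polynomial ring. -/
def polynomialEquivAdjoin {f : F} (hf : Transcendental k f) :
    Polynomial k ≃ₐ[k] Algebra.adjoin k {f} :=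
  (AlgEquiv.ofInjective (Polynomial.aeval f)
    (transcendental_iff_injective.1 hf)).trans
    (Subalgebra.equivOfEq _ _ (Algebra.adjoin_singleton_eq_range_aeval k f).symm)

theorem polynomialEquivAdjoin_X {f : F} (hf : Transcendental k f) :
    polynomialEquivAdjoin hf Polynomial.X = ⟨f, Algebra.self_mem_adjoin_singleton k f⟩ :=
  Subtype.ext (Polynomial.aeval_X f)

open scoped IntermediateField.algebraAdjoinAdjoin in
/-- The zeros of a transcendental element `f` of a function field are finite in number, and
counted with multiplicity their degrees add up to `[F : k(f)]`. -/
theorem exists_finset_zeros [Finite k] (h : IsFunctionFieldLE k F) {f : F}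
    (hf : Transcendental k f) :
    ∃ s : Finset (Place k F), (∀ P, P ∈ s ↔ f ∈ P.ring.nonunits) ∧
      (∀ P ∈ s, P.IsDiscrete ∧ 0 < P.degree) ∧
      ∑ P ∈ s, P.ord f * (P.degree : ℤ) = finrank k⟮f⟯ F := by
  have := h.finiteDimensional hf
  let R := Algebra.adjoin k {f}
  let t : R := ⟨f, Algebra.self_mem_adjoin_singleton k f⟩
  let E := polynomialEquivAdjoin hf
  have hE : E Polynomial.X = t := polynomialEquivAdjoin_X hf
  have hpid : IsPrincipalIdealRing R := .of_surjective E.toRingEquiv.toRingHom E.surjective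
  have ht : t ≠ 0 := by
    rw [← hE]
    simp
  let π : R →ₐ[k] k := (Polynomial.aeval 0).comp E.symm.toAlgHom
  have hπ : Function.Surjective π := fun a => ⟨algebraMap k R a, by simp⟩
  have hker : RingHom.ker π = Ideal.span {t} := by
    ext x
    obtain ⟨y, rfl⟩ := E.surjective x
    have h1 : π (E y) = y.coeff 0 := by
      simp [π, Polynomial.coeff_zero_eq_aeval_zero]
    rw [RingHom.mem_ker, h1, ← Polynomial.X_dvd_iff, Ideal.mem_span_singleton, ← hE,
      map_dvd_iff]
  have hmax : (Ideal.span {t}).IsMaximal := hker ▸ RingHom.ker_isMaximal_of_surjective _ hπ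
  let q : (R ⧸ Ideal.span {t}) ≃ₐ[k] k :=
    (Ideal.quotientEquivAlgOfEq k hker.symm).trans (Ideal.quotientKerAlgEquivOfSurjective hπ)
  have : FiniteDimensional k (R ⧸ Ideal.span {t}) := Module.Finite.equiv q.symm.toLinearEquiv
  have hq : finrank k (R ⧸ Ideal.span {t}) = 1 := by
    rw [q.toLinearEquiv.finrank_eq, finrank_self]
  obtain ⟨p, hp⟩ := ExpChar.exists k
  have : ExpChar R p := expChar_of_injective_algebraMap (algebraMap k R).injective p
  have : Algebra.FiniteType k R :=
    (Subalgebra.fg_iff_finiteType _).1 ⟨{f}, by simp [R]⟩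
  have := finite_integralClosure_of_finite_iterateFrobenius (R := R) k⟮f⟯ (F := F) p
    (finite_iterateFrobenius (k := k) p)
  obtain ⟨s, hs, hs', hsum⟩ := exists_finset_sum_ord_mul_degree_of_finite (k := k) (R := R)
    k⟮f⟯ (F := F) ht hmax
  refine ⟨s, fun P => ?_, hs', ?_⟩
  · rw [hs]
    refine ⟨fun H => H.2, fun H => ⟨fun r => ?_, H⟩⟩
    have hle : Algebra.adjoin k {f} ≤
        { P.ring.toSubring with algebraMap_mem' := P.algebraMap_mem } :=
      Algebra.adjoin_le (by
        rintro _ rfl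
        exact P.ring.nonunits_subset H)
    exact hle r.2
  · rw [hq, mul_one] at hsum
    exact hsum

/-- Elements of the maximal ideal of a place are zero or transcendental. -/
theorem Place.transcendental_of_mem_nonunits (P : Place k F) {f : F} (hf : f ∈ P.ring.nonunits)
    (hf0 : f ≠ 0) : Transcendental k f := by
  intro halg
  have h1 : f⁻¹ ∈ P.ring :=
    mem_valuationSubring_of_isIntegral P.ring P.algebraMap_mem halg.inv.isIntegral
  rcases (ValuationSubring.mem_nonunits_iff_or P.ring).1 hf with h | h
  exacts [hf0 h, h h1]

theorem Place.exists_mem_nonunits (P : Place k F) : ∃ f ∈ P.ring.nonunits, f ≠ 0 := by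
  by_contra! H
  refine P.ne_top (eq_top_iff.2 fun x _ => ?_)
  by_contra hx
  have hx0 : x ≠ 0 := by rintro rfl; exact hx P.ring.zero_mem
  exact inv_ne_zero hx0 (H _ ((ValuationSubring.inv_mem_nonunits_iff P.ring).2 (Or.inr hx)))

/-- Every place of a function field is a zero of some transcendental `f`, hence discrete and of
finite degree. -/
theorem IsFunctionFieldLE.isDiscrete_and_degree_pos [Finite k] (h : IsFunctionFieldLE k F)
    (P : Place k F) : P.IsDiscrete ∧ 0 < P.degree := by
  obtain ⟨f, hf, hf0⟩ := P.exists_mem_nonunits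
  obtain ⟨s, hs, hs', -⟩ := exists_finset_zeros h (P.transcendental_of_mem_nonunits hf hf0)
  exact hs' P ((hs P).2 hf)

theorem IsFunctionFieldLE.isDiscrete [Finite k] (h : IsFunctionFieldLE k F)
    (P : Place k F) : P.IsDiscrete :=
  (h.isDiscrete_and_degree_pos P).1

/-- Every nonzero element of a function field has a divisor, and its degree is zero: it has
as many zeros as poles, since `k(f) = k(f⁻¹)`. -/
theorem IsFunctionFieldLE.exists_principal_divisor [Finite k] (h : IsFunctionFieldLE k F) {f : F}
    (hf0 : f ≠ 0) : ∃ A : Divisor k F, (∀ P, A P = P.ord f) ∧ A.degree = 0 := by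
  classical
  by_cases hf : Transcendental k f
  · have hf' : Transcendental k f⁻¹ := fun H => hf (by simpa using H.inv)
    obtain ⟨s, hs, -, hsum⟩ := exists_finset_zeros h hf
    obtain ⟨s', hs', -, hsum'⟩ := exists_finset_zeros h hf'
    have hdisj : Disjoint s s' := by
      rw [Finset.disjoint_left]
      intro P h1 h2
      rw [hs, ← (h.isDiscrete P).ord_pos_iff hf0] at h1
      rw [hs', ← (h.isDiscrete P).ord_pos_iff (inv_ne_zero hf0), (h.isDiscrete P).ord_inv hf0] at h2
      omega
    have hfield : k⟮f⁻¹⟯ = k⟮f⟯ := by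
      refine le_antisymm ?_ ?_ <;> rw [IntermediateField.adjoin_simple_le_iff]
      · exact inv_mem (IntermediateField.mem_adjoin_simple_self k f)
      · simpa using inv_mem (IntermediateField.mem_adjoin_simple_self k f⁻¹)
    let A : Divisor k F := Finsupp.onFinset (s ∪ s') (fun P => P.ord f) (by
      intro P hP
      rw [Finset.mem_union, hs, hs', ← (h.isDiscrete P).ord_pos_iff hf0,
        ← (h.isDiscrete P).ord_pos_iff (inv_ne_zero hf0), (h.isDiscrete P).ord_inv hf0]
      omega)
    refine ⟨A, fun P => rfl, ?_⟩
    have h1 : A.degree = ∑ P ∈ s ∪ s', P.ord f * (P.degree : ℤ) :=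
      Finsupp.onFinset_sum _ (fun _ => zero_mul _)
    rw [hfield, Finset.sum_congr rfl (fun P _ => by rw [(h.isDiscrete P).ord_inv hf0, neg_mul]),
      Finset.sum_neg_distrib] at hsum'
    rw [h1, Finset.sum_union hdisj, hsum]
    omega
  · refine ⟨0, fun P => ?_, by simp [Divisor.degree]⟩
    rw [Transcendental, not_not] at hf
    have h1 := mem_valuationSubring_of_isIntegral P.ring P.algebraMap_mem hf.isIntegral
    have h2 := mem_valuationSubring_of_isIntegral P.ring P.algebraMap_mem hf.inv.isIntegral
    rw [← (h.isDiscrete P).ord_nonneg_iff hf0] at h1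
    rw [← (h.isDiscrete P).ord_nonneg_iff (inv_ne_zero hf0), (h.isDiscrete P).ord_inv hf0] at h2
    rw [Finsupp.zero_apply]
    omega

end FunctionField

/-! ### Constant field extensions -/

section ConstantFieldExtension

open scoped IntermediateField

open Polynomial in
/-- A constant field extension by a finite separable extension of the full constant field is
separable of the same degree: the minimal polynomial of a primitive element stays irreducible. -/
theorem isSeparable_and_finrank_of_adjoin_eq_top {k F k' F' : Type*} [Field k] [Field F]
    [Field k'] [Field F'] [Algebra k F] [Algebra k k'] [Algebra k F'] [Algebra F F']
    [Algebra k' F'] [IsScalarTower k F F'] [IsScalarTower k k' F'] [FiniteDimensional k k']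
    [Algebra.IsSeparable k k']
    (hfull : ∀ x : F, IsAlgebraic k x → x ∈ Set.range (algebraMap k F))
    (hF' : IntermediateField.adjoin F (Set.range (algebraMap k' F')) = ⊤) :
    FiniteDimensional F F' ∧ Algebra.IsSeparable F F' ∧ finrank F F' = finrank k k' := by
  obtain ⟨α, hα⟩ := Field.exists_primitive_element k k'
  set β := algebraMap k' F' α with hβ
  have hαint : IsIntegral k α := Algebra.IsIntegral.isIntegral α
  have hβk : IsIntegral k β := hαint.algebraMap
  have hβF : IsIntegral F β := hβk.tower_top
  have hpk : minpoly k β = minpoly k α :=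
    minpoly.algebraMap_eq (algebraMap k' F').injective α
  have htop : F⟮β⟯ = ⊤ := by
    rw [eq_top_iff, ← hF', IntermediateField.adjoin_le_iff]
    rintro _ ⟨x, rfl⟩
    have hx : x ∈ k⟮α⟯ := hα ▸ IntermediateField.mem_top
    rw [← IntermediateField.mem_toSubalgebra,
      IntermediateField.adjoin_simple_toSubalgebra_of_isAlgebraic hαint.isAlgebraic,
      Algebra.adjoin_singleton_eq_range_aeval] at hx
    obtain ⟨p, rfl⟩ := hx
    change algebraMap k' F' (aeval α p) ∈ F⟮β⟯
    rw [← aeval_algebraMap_apply, ← aeval_map_algebraMap F]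
    exact IntermediateField.algebra_adjoin_le_adjoin F {β} (aeval_mem_adjoin_singleton F β)
  have hdvd : minpoly F β ∣ (minpoly k β).map (algebraMap k F) :=
    minpoly.dvd_map_of_isScalarTower k F β
  have hdeg : (minpoly F β).natDegree = (minpoly k β).natDegree := by
    -- The coefficients are integral over `k`, hence lie in the full constant field `k`.
    have hlift : minpoly F β ∈ Polynomial.lifts (algebraMap k F) := by
      rw [Polynomial.lifts_iff_coeff_lifts]
      intro n
      exact hfull _ (Polynomial.isIntegral_coeff_of_dvd _ _ (minpoly.monic hβk)
        (minpoly.monic hβF) hdvd n).isAlgebraic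
    obtain ⟨q, hq⟩ := (Polynomial.mem_lifts _).1 hlift
    refine le_antisymm ?_ ?_
    · have := Polynomial.natDegree_le_of_dvd hdvd
        ((minpoly.monic hβk).map (algebraMap k F)).ne_zero
      rwa [Polynomial.natDegree_map] at this
    · rw [← hq, Polynomial.natDegree_map]
      refine Polynomial.natDegree_le_of_dvd (minpoly.dvd k β ?_) ?_
      · rw [← aeval_map_algebraMap F, hq, minpoly.aeval]
      · rintro rfl
        exact minpoly.ne_zero hβF (by rw [← hq, Polynomial.map_zero])
  have hsep : Algebra.IsSeparable F F⟮β⟯ := by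
    rw [IntermediateField.isSeparable_adjoin_simple_iff_isSeparable]
    refine Polynomial.Separable.of_dvd ?_ hdvd
    rw [hpk]
    exact Polynomial.Separable.map (Algebra.IsSeparable.isSeparable k α)
  have hfin : FiniteDimensional F F⟮β⟯ := IntermediateField.adjoin.finiteDimensional hβF
  have hrank := IntermediateField.adjoin.finrank hβF
  have hrank' := IntermediateField.adjoin.finrank hαint
  rw [hα, IntermediateField.finrank_top'] at hrank'
  rw [hdeg, hpk, ← hrank', htop, IntermediateField.finrank_top'] at hrank
  rw [htop] at hsep hfin
  exact ⟨Module.Finite.equiv (IntermediateField.topEquiv (F := F) (E := F')).toLinearEquiv,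
    AlgEquiv.Algebra.isSeparable (IntermediateField.topEquiv (F := F) (E := F')), hrank⟩

/-- Every ideal of the valuation ring of a discrete place is generated by an element of least
order. -/
theorem Place.IsDiscrete.isPrincipalIdealRing {k F : Type*} [Field k] [Field F] [Algebra k F]
    {P : Place k F} (h : P.IsDiscrete) : IsPrincipalIdealRing P.ring := by
  classical
  refine ⟨fun I => ?_⟩
  by_cases hI : I = ⊥
  · rw [hI]; infer_instance
  obtain ⟨x₀, hx₀, hx₀'⟩ := Submodule.exists_mem_ne_zero_of_ne_bot hI
  have hex : ∃ n : ℕ, ∃ x ∈ I, x ≠ 0 ∧ (P.ord (x : F)).toNat = n := ⟨_, x₀, hx₀, hx₀', rfl⟩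
  obtain ⟨x, hx, hx0, hxn⟩ := Nat.find_spec hex
  have hxF : (x : F) ≠ 0 := by simpa using hx0
  refine ⟨x, le_antisymm (fun y hy => ?_) ((Ideal.span_singleton_le_iff_mem I).2 hx)⟩
  by_cases hy0 : y = 0
  · rw [hy0]; exact Submodule.zero_mem _
  have hyF : (y : F) ≠ 0 := by simpa using hy0
  have h1 := Nat.find_min' hex ⟨y, hy, hy0, rfl⟩
  rw [← hxn] at h1
  have h2 := (h.ord_nonneg_iff hxF).2 x.2
  have h3 := (h.ord_nonneg_iff hyF).2 y.2
  have h4 : (x : F)⁻¹ * y ∈ P.ring := by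
    rw [← h.ord_nonneg_iff (mul_ne_zero (inv_ne_zero hxF) hyF), h.ord_mul (inv_ne_zero hxF) hyF,
      h.ord_inv hxF]
    omega
  refine Ideal.mem_span_singleton.2 ⟨⟨_, h4⟩, Subtype.ext ?_⟩
  simp [hxF]

theorem Place.IsDiscrete.maximalIdeal_eq_span {k F : Type*} [Field k] [Field F] [Algebra k F]
    {P : Place k F} (h : P.IsDiscrete) {t : P.ring} (ht : P.ord (t : F) = 1) (ht0 : (t : F) ≠ 0) :
    IsLocalRing.maximalIdeal P.ring = Ideal.span {t} := by
  ext x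
  rw [← ValuationSubring.coe_mem_nonunits_iff, Ideal.mem_span_singleton]
  by_cases hx0 : x = 0
  · rw [hx0]
    simp [P.ring.nonunits.zero_mem]
  have hxF : (x : F) ≠ 0 := by simpa using hx0
  rw [← h.ord_pos_iff hxF]
  constructor
  · intro hx
    have h4 : (t : F)⁻¹ * x ∈ P.ring := by
      rw [← h.ord_nonneg_iff (mul_ne_zero (inv_ne_zero ht0) hxF),
        h.ord_mul (inv_ne_zero ht0) hxF, h.ord_inv ht0]
      omega
    refine ⟨⟨_, h4⟩, Subtype.ext ?_⟩
    simp [ht0]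
  · rintro ⟨y, rfl⟩
    have hyF : (y : F) ≠ 0 := by rintro hy; simp [hy] at hxF
    have := (h.ord_nonneg_iff hyF).2 y.2
    change 0 < P.ord ((t : F) * y)
    rw [h.ord_mul ht0 hyF]
    omega

variable {k F k' F' : Type*} [Field k] [Field F]
    [Field k'] [Field F'] [Algebra k F] [Algebra k k'] [Algebra k F'] [Algebra F F']
    [Algebra k' F'] [IsScalarTower k F F'] [IsScalarTower k k' F']

variable (k) in
/-- A place of `F' / k'`, regarded as a place of `F' / k`. -/
def Place.restrictConstants (P : Place k' F') : Place k F' where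
  ring := P.ring
  algebraMap_mem a := by
    rw [IsScalarTower.algebraMap_apply k k' F']
    exact P.algebraMap_mem _
  ne_top := P.ne_top

/-- A place of `F' / k` contains every algebraic extension `k'` of `k` in `F'`. -/
def Place.extendConstants (k' : Type*) [Field k'] [Algebra k k'] [Algebra k' F']
    [IsScalarTower k k' F'] [Algebra.IsAlgebraic k k'] (P : Place k F') : Place k' F' where
  ring := P.ring
  algebraMap_mem a := mem_valuationSubring_of_isIntegral P.ring P.algebraMap_mem
    ((Algebra.IsIntegral.isIntegral (R := k) a).algebraMap)
  ne_top := P.ne_top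

theorem Place.degree_restrictConstants (P : Place k' F') :
    (P.restrictConstants k).degree = finrank k k' * P.degree := by
  let : Algebra k P.ring := ((algebraMap k F').codRestrict P.ring.toSubring
    (P.restrictConstants k).algebraMap_mem).toAlgebra
  have : IsScalarTower k k' P.ring := .of_algebraMap_eq fun a =>
    Subtype.ext (IsScalarTower.algebraMap_apply k k' F' a)
  have : IsScalarTower k k' (IsLocalRing.ResidueField P.ring) := .of_algebraMap_eq fun a => by
    change IsLocalRing.residue P.ring (algebraMap k P.ring a) =
      IsLocalRing.residue P.ring (algebraMap k' P.ring (algebraMap k k' a))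
    rw [IsScalarTower.algebraMap_apply k k' P.ring]
  exact (finrank_mul_finrank k k' (IsLocalRing.ResidueField P.ring)).symm

end ConstantFieldExtension

/-! ### Places above a place, and the conorm -/

section Conorm

theorem Place.IsDiscrete.ord_zpow {k F : Type*} [Field k] [Field F] [Algebra k F]
    {P : Place k F} (h : P.IsDiscrete) {f : F} (hf : f ≠ 0) (m : ℤ) :
    P.ord (f ^ m) = m * P.ord f := by
  obtain ⟨w, h⟩ := h
  have := map_zpow₀ w f m
  rw [h.eq_exp_neg_ord hf, h.eq_exp_neg_ord (zpow_ne_zero m hf), ← exp_zsmul, exp_inj,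
    smul_neg, smul_eq_mul] at this
  omega

section Degree

variable {k F : Type*} [Field k] [Field F] [Algebra k F]

theorem Divisor.degree_add (A B : Divisor k F) : (A + B).degree = A.degree + B.degree :=
  Finsupp.sum_add_index' (fun _ => zero_mul _) fun _ _ _ => add_mul _ _ _

/-- The degree as a homomorphism. -/
def Divisor.degreeHom : Divisor k F →+ ℤ where
  toFun := Divisor.degree
  map_zero' := Finsupp.sum_zero_index
  map_add' := Divisor.degree_add

theorem Divisor.degree_single (P : Place k F) (m : ℤ) :
    Divisor.degree (Finsupp.single P m) = m * P.degree :=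
  Finsupp.sum_single_index (zero_mul _)

end Degree

variable {k F k' F' : Type*} [Field k] [Field F] [Field k'] [Field F'] [Algebra k F]
  [Algebra F F'] [Algebra k' F']

/-- The places of `F'` above `P` are those containing `O_P` at which a local parameter of `P`
vanishes. -/
theorem Place.liesOver_iff {P : Place k F} (h : P.IsDiscrete) {t : F} (ht : P.ord t = 1)
    (ht0 : t ≠ 0) (P' : Place k' F') :
    P'.LiesOver P ↔ (∀ r : P.ring, algebraMap P.ring F' r ∈ P'.ring) ∧
      algebraMap F F' t ∈ P'.ring.nonunits := by
  have ht0' : algebraMap F F' t ≠ 0 := by simpa using ht0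
  constructor
  · intro H
    refine ⟨fun r => ?_, ?_⟩
    · have hr : (r : F) ∈ P'.ring.comap (algebraMap F F') := H.symm ▸ r.2
      exact hr
    · refine (ValuationSubring.mem_nonunits_iff_or _).2 (Or.inr fun hmem => ?_)
      rw [← map_inv₀] at hmem
      have hr : t⁻¹ ∈ P.ring := H ▸ (ValuationSubring.mem_comap.2 hmem)
      rw [← h.ord_nonneg_iff (inv_ne_zero ht0), h.ord_inv ht0] at hr
      omega
  · rintro ⟨H1, H2⟩
    refine le_antisymm (fun x hx => ?_) (fun x hx => H1 ⟨x, hx⟩)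
    have hx' : algebraMap F F' x ∈ P'.ring := hx
    by_cases hx0 : x = 0
    · rw [hx0]; exact P.ring.zero_mem
    rw [← h.ord_nonneg_iff hx0]
    -- If `v_P(x) < 0`, then `t⁻¹ = x * (x * t)⁻¹` would lie in `O_P'`.
    by_contra! hneg
    have hxt : (x * t)⁻¹ ∈ P.ring := by
      rw [← h.ord_nonneg_iff (inv_ne_zero (mul_ne_zero hx0 ht0)),
        h.ord_inv (mul_ne_zero hx0 ht0), h.ord_mul hx0 ht0]
      omega
    have hinv : (algebraMap F F' t)⁻¹ ∈ P'.ring := by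
      have := P'.ring.mul_mem _ _ hx' (H1 ⟨_, hxt⟩)
      have heq : algebraMap F F' x * algebraMap P.ring F' ⟨_, hxt⟩ = (algebraMap F F' t)⁻¹ := by
        change algebraMap F F' x * algebraMap F F' (x * t)⁻¹ = (algebraMap F F' t)⁻¹
        rw [← map_mul, ← map_inv₀]
        congr 1
        field_simp
      rwa [heq] at this
    rcases (ValuationSubring.mem_nonunits_iff_or _).1 H2 with h0 | h0
    exacts [ht0' h0, h0 hinv]

/-- The order at `P' | P` of an element of `F` is its order at `P` times the ramification index,
which is the order at `P'` of a local parameter of `P`. -/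
theorem Place.LiesOver.ramificationIndex_spec {P : Place k F} {P' : Place k' F'}
    (H : P'.LiesOver P) (h : P.IsDiscrete) (h' : P'.IsDiscrete) :
    0 < ramificationIndex P' P ∧
      ∀ x : F, x ≠ 0 → P'.ord (algebraMap F F' x) = (ramificationIndex P' P : ℤ) * P.ord x := by
  obtain ⟨t, ht0, ht⟩ := h.exists_ord_eq_one
  have ht0' : algebraMap F F' t ≠ 0 := by simpa using ht0
  have hpos := (h'.ord_pos_iff ht0').2 ((Place.liesOver_iff h ht ht0 P').1 H).2
  have hmem : ∀ x : F, x ∈ P.ring ↔ algebraMap F F' x ∈ P'.ring := fun x => by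
    rw [← H]; exact ValuationSubring.mem_comap
  have hex : ∃ e : ℕ, ∀ x : F, x ≠ 0 → P'.ord (algebraMap F F' x) = (e : ℤ) * P.ord x := by
    refine ⟨(P'.ord (algebraMap F F' t)).toNat, fun x hx => ?_⟩
    have hu0 : x * t ^ (-P.ord x) ≠ 0 := mul_ne_zero hx (zpow_ne_zero _ ht0)
    have hu : P.ord (x * t ^ (-P.ord x)) = 0 := by
      rw [h.ord_mul hx (zpow_ne_zero _ ht0), h.ord_zpow ht0, ht]
      omega
    have hx0' : algebraMap F F' x ≠ 0 := by simpa using hx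
    have hu0' : algebraMap F F' (x * t ^ (-P.ord x)) ≠ 0 :=
      (map_ne_zero _).2 hu0
    have h1 := (h'.ord_nonneg_iff hu0').2 ((hmem _).1 ((h.ord_nonneg_iff hu0).1 hu.ge))
    have h2 := (h'.ord_nonneg_iff (inv_ne_zero hu0')).2 (by
      rw [← map_inv₀, ← hmem, ← h.ord_nonneg_iff (inv_ne_zero hu0), h.ord_inv hu0, hu, neg_zero])
    rw [h'.ord_inv hu0'] at h2
    rw [map_mul, map_zpow₀, h'.ord_mul hx0' (zpow_ne_zero _ ht0'), h'.ord_zpow ht0'] at h1 h2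
    rw [Int.toNat_of_nonneg hpos.le]
    linarith
  have hspec : ∀ x : F, x ≠ 0 →
      P'.ord (algebraMap F F' x) = (ramificationIndex P' P : ℤ) * P.ord x := by
    rw [ramificationIndex, dif_pos hex]
    exact hex.choose_spec
  refine ⟨?_, hspec⟩
  rw [hspec t ht0, ht, mul_one] at hpos
  exact_mod_cast hpos

/-- If `[F' : F] = [k' : k]`, then the places above `P` are finite in number and
`∑ e(P' | P) deg P' = deg P`. This is the fundamental identity over the valuation ring of `P`, with
degrees taken over `k`, divided by `[k' : k]`. -/
theorem exists_finset_liesOver [Algebra k k'] [Algebra k F'] [IsScalarTower k F F']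
    [IsScalarTower k k' F'] [Finite k] [FiniteDimensional k k'] [FiniteDimensional F F']
    [Algebra.IsSeparable F F'] (hrank : finrank F F' = finrank k k')
    (hFF : IsFunctionFieldLE k F) (hFF' : IsFunctionFieldLE k' F') (P : Place k F) :
    ∃ s : Finset (Place k' F'), (∀ P', P' ∈ s ↔ P'.LiesOver P) ∧
      ∑ P' ∈ s, (ramificationIndex P' P : ℤ) * (P'.degree : ℤ) = P.degree := by
  obtain ⟨h, hdeg⟩ := hFF.isDiscrete_and_degree_pos P
  have : Finite k' := Module.finite_of_finite k
  obtain ⟨t, ht0, ht⟩ := h.exists_ord_eq_one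
  have htmem : t ∈ P.ring := (h.ord_nonneg_iff ht0).1 (by omega)
  let τ : P.ring := ⟨t, htmem⟩
  have hspan := h.maximalIdeal_eq_span (t := τ) ht ht0
  have hmax : (Ideal.span {τ}).IsMaximal := hspan ▸ IsLocalRing.maximalIdeal.isMaximal P.ring
  let q : (P.ring ⧸ Ideal.span {τ}) ≃ₐ[k] IsLocalRing.ResidueField P.ring :=
    Ideal.quotientEquivAlgOfEq k hspan.symm
  have hq : finrank k (P.ring ⧸ Ideal.span {τ}) = P.degree := q.toLinearEquiv.finrank_eq
  have : FiniteDimensional k (P.ring ⧸ Ideal.span {τ}) :=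
    Module.finite_of_finrank_pos (hq ▸ hdeg)
  have := h.isPrincipalIdealRing
  have : IsScalarTower k P.ring F' := .of_algebraMap_eq fun a =>
    IsScalarTower.algebraMap_apply k F F' a
  have := IsIntegralClosure.finite P.ring F F' (integralClosure P.ring F')
  obtain ⟨s, hs, -, hsum⟩ := exists_finset_sum_ord_mul_degree_of_finite (k := k) (R := P.ring)
    F (F := F') (t := τ) (by simpa [τ, Subtype.ext_iff] using ht0) hmax
  let ι : Place k F' ↪ Place k' F' := ⟨Place.extendConstants k', fun Q Q' hQ =>
    Place.ext (congrArg (fun Q : Place k' F' => Q.ring) hQ)⟩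
  have hover : ∀ P', P' ∈ s.map ι ↔ P'.LiesOver P := by
    intro P'
    rw [Place.liesOver_iff h ht ht0, Finset.mem_map]
    constructor
    · rintro ⟨Q, hQ, rfl⟩
      exact (hs Q).1 hQ
    · intro H
      exact ⟨P'.restrictConstants k, (hs _).2 H, rfl⟩
  refine ⟨s.map ι, hover, ?_⟩
  rw [hq, hrank] at hsum
  have hpos : (0 : ℤ) < finrank k k' := by exact_mod_cast finrank_pos (R := k) (M := k')
  refine mul_left_cancel₀ hpos.ne' ?_
  rw [Finset.mul_sum, Finset.sum_map]
  push_cast at hsum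
  rw [← hsum]
  refine Finset.sum_congr rfl fun Q hQ => ?_
  have hspec := (((hover (ι Q)).1 (Finset.mem_map_of_mem ι hQ)).ramificationIndex_spec h
    (hFF'.isDiscrete _)).2 t ht0
  rw [ht, mul_one] at hspec
  have hdegQ : Q.degree = finrank k k' * (ι Q).degree :=
    Place.degree_restrictConstants (k := k) (ι Q)
  have hord : Q.ord (algebraMap P.ring F' τ) = (ι Q).ord (algebraMap F F' t) := rfl
  rw [hord, hspec, hdegQ]
  push_cast
  ring

theorem conormPlace_eq_sum {P : Place k F} {s : Finset (Place k' F')}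
    (hs : ∀ P', P' ∈ s ↔ P'.LiesOver P) :
    conormPlace k' F' P = ∑ P' ∈ s, Finsupp.single P' (ramificationIndex P' P : ℤ) := by
  rw [conormPlace, ← finsum_mem_coe_finset]
  simp only [Finset.mem_coe, hs]

open Classical in
theorem conormPlace_apply {P : Place k F} {s : Finset (Place k' F')}
    (hs : ∀ P', P' ∈ s ↔ P'.LiesOver P) (P' : Place k' F') :
    conormPlace k' F' P P' = if P'.LiesOver P then (ramificationIndex P' P : ℤ) else 0 := by
  rw [conormPlace_eq_sum hs, Finsupp.finsetSum_apply]
  simp [Finsupp.single_apply, hs]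

theorem degree_conormPlace {P : Place k F} {s : Finset (Place k' F')}
    (hs : ∀ P', P' ∈ s ↔ P'.LiesOver P) :
    Divisor.degree (conormPlace k' F' P) =
      ∑ P' ∈ s, (ramificationIndex P' P : ℤ) * (P'.degree : ℤ) := by
  rw [conormPlace_eq_sum hs]
  change Divisor.degreeHom _ = _
  rw [map_sum]
  exact Finset.sum_congr rfl fun P' _ => Divisor.degree_single _ _

theorem degree_conorm (hdeg : ∀ P : Place k F,
    Divisor.degree (conormPlace k' F' P) = (P.degree : ℤ)) (A : Divisor k F) :
    (conorm k' F' A).degree = A.degree := by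
  rw [conorm, Finsupp.sum]
  change Divisor.degreeHom _ = _
  rw [map_sum, Divisor.degree, Finsupp.sum]
  refine Finset.sum_congr rfl fun P _ => ?_
  rw [map_zsmul, smul_eq_mul]
  congr 1
  exact hdeg P

theorem conorm_apply {P : Place k F} {P' : Place k' F'} (H : P'.LiesOver P)
    (hfin : ∀ P : Place k F, ∃ s : Finset (Place k' F'), ∀ P', P' ∈ s ↔ P'.LiesOver P)
    (A : Divisor k F) :
    conorm k' F' A P' = (ramificationIndex P' P : ℤ) * A P := by
  classical
  rw [conorm, Finsupp.sum, Finsupp.finsetSum_apply, Finset.sum_eq_single P]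
  · obtain ⟨s, hs⟩ := hfin P
    rw [Finsupp.smul_apply, conormPlace_apply hs, if_pos H, smul_eq_mul, mul_comm]
  · intro Q _ hQ
    obtain ⟨s, hs⟩ := hfin Q
    rw [Finsupp.smul_apply, conormPlace_apply hs, if_neg, smul_zero]
    exact fun H' => hQ (Place.ext (H'.symm.trans H))
  · intro hP
    rw [Finsupp.notMem_support_iff.1 hP, zero_smul, Finsupp.zero_apply]

/-- Every place of `F'` lies over a place of `F`. -/
theorem Place.exists_liesOver [Algebra k k'] [Algebra k F'] [IsScalarTower k F F']
    [IsScalarTower k k' F'] [Algebra.IsAlgebraic F F'] (P' : Place k' F') :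
    ∃ P : Place k F, P'.LiesOver P := by
  refine ⟨⟨P'.ring.comap (algebraMap F F'), fun a => ?_, fun htop => P'.ne_top ?_⟩, rfl⟩
  · rw [ValuationSubring.mem_comap, ← IsScalarTower.algebraMap_apply,
      IsScalarTower.algebraMap_apply k k' F']
    exact P'.algebraMap_mem _
  · refine eq_top_iff.2 fun x _ => mem_valuationSubring_of_isIntegral (R := F) P'.ring (fun r => ?_)
      (Algebra.IsIntegral.isIntegral x)
    have hr : r ∈ P'.ring.comap (algebraMap F F') := htop ▸ ValuationSubring.mem_top r
    exact hr

/-- Above a rational place there is a single place; it is unramified and rational. -/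
theorem exists_conormPlace_eq_single {P : Place k F} (hP : P.IsRational) {s : Finset (Place k' F')}
    (hs : ∀ P', P' ∈ s ↔ P'.LiesOver P) (hpos : ∀ P' ∈ s, 0 < ramificationIndex P' P)
    (hdeg : ∀ P' : Place k' F', 0 < P'.degree)
    (hsum : ∑ P' ∈ s, (ramificationIndex P' P : ℤ) * (P'.degree : ℤ) = P.degree) :
    ∃ P' : Place k' F', conormPlace k' F' P = Finsupp.single P' 1 ∧ P'.LiesOver P ∧
      P'.IsRational := by
  rw [hP] at hsum
  have hsum' : ∑ P' ∈ s, ramificationIndex P' P * P'.degree = 1 := by exact_mod_cast hsum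
  have hcard : s.card ≤ 1 := by
    rw [← hsum', Finset.card_eq_sum_ones]
    exact Finset.sum_le_sum fun P' hP' => Nat.mul_pos (hpos P' hP') (hdeg P')
  have hne : s.Nonempty := by
    rw [Finset.nonempty_iff_ne_empty]
    rintro rfl
    simp at hsum'
  obtain ⟨P', rfl⟩ := Finset.card_eq_one.1 (le_antisymm hcard hne.card_pos)
  rw [Finset.sum_singleton, mul_eq_one] at hsum'
  refine ⟨P', ?_, (hs P').1 (Finset.mem_singleton_self P'), hsum'.2⟩
  rw [conormPlace_eq_sum hs, Finset.sum_singleton, hsum'.1, Nat.cast_one]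

end Conorm

/-! ### Evaluation at rational places and algebraic geometry codes -/

section Evaluation

variable {k F : Type*} [Field k] [Field F] [Algebra k F] {P : Place k F}

theorem Place.mul_mem_nonunits (P : Place k F) {x y : F} (hx : x ∈ P.ring)
    (hy : y ∈ P.ring.nonunits) : x * y ∈ P.ring.nonunits := by
  rw [ValuationSubring.mem_nonunits_iff] at hy ⊢
  rw [map_mul]
  exact lt_of_le_of_lt (mul_le_of_le_one_left' ((P.ring.valuation_le_one_iff x).2 hx)) hy

theorem Place.eq_zero_of_algebraMap_mem_nonunits (P : Place k F) {a : k}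
    (ha : algebraMap k F a ∈ P.ring.nonunits) : a = 0 := by
  rcases (ValuationSubring.mem_nonunits_iff_or _).1 ha with h | h
  · simpa using h
  · rw [← map_inv₀] at h
    exact absurd (P.algebraMap_mem _) h

theorem Place.value_eq {f : F} {a : k} (h : f - algebraMap k F a ∈ P.ring.nonunits) :
    P.value f = a := by
  have hex : ∃ a : k, f - algebraMap k F a ∈ P.ring.nonunits := ⟨a, h⟩
  rw [value, dif_pos hex]
  have := sub_mem h hex.choose_spec
  rw [sub_sub_sub_cancel_left, ← map_sub] at this
  exact sub_eq_zero.1 (P.eq_zero_of_algebraMap_mem_nonunits this)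

theorem Place.IsRational.sub_value_mem (hP : P.IsRational) {f : F} (hf : f ∈ P.ring) :
    f - algebraMap k F (P.value f) ∈ P.ring.nonunits := by
  obtain ⟨a, ha⟩ := (Algebra.finrank_eq_one_iff_bijective_algebraMap
    (F := k) (E := IsLocalRing.ResidueField P.ring)).1 hP |>.surjective
    (IsLocalRing.residue P.ring ⟨f, hf⟩)
  have h1 : IsLocalRing.residue P.ring (⟨f, hf⟩ - algebraMap k P.ring a) = 0 := by
    rw [map_sub, ← ha]
    exact sub_self _
  rw [IsLocalRing.residue_eq_zero_iff, ← ValuationSubring.coe_mem_nonunits_iff] at h1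
  have h2 : f - algebraMap k F a ∈ P.ring.nonunits := h1
  rwa [P.value_eq h2]

theorem Place.IsRational.value_add (hP : P.IsRational) {f g : F} (hf : f ∈ P.ring)
    (hg : g ∈ P.ring) : P.value (f + g) = P.value f + P.value g := by
  refine P.value_eq ?_
  have := add_mem (hP.sub_value_mem hf) (hP.sub_value_mem hg)
  rwa [map_add, add_sub_add_comm]

theorem Place.value_algebraMap (P : Place k F) (a : k) : P.value (algebraMap k F a) = a :=
  P.value_eq (by simp [P.ring.nonunits.zero_mem])

theorem Place.IsRational.value_mul (hP : P.IsRational) {f g : F} (hf : f ∈ P.ring)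
    (hg : g ∈ P.ring) : P.value (f * g) = P.value f * P.value g := by
  refine P.value_eq ?_
  have h1 := P.mul_mem_nonunits hf (hP.sub_value_mem hg)
  have h2 := P.mul_mem_nonunits (P.algebraMap_mem (P.value g)) (hP.sub_value_mem hf)
  have := add_mem h1 h2
  rw [map_mul]
  convert this using 1
  ring

theorem Place.IsRational.mem_nonunits_iff_value_eq_zero (hP : P.IsRational) {f : F}
    (hf : f ∈ P.ring) : f ∈ P.ring.nonunits ↔ P.value f = 0 := by
  constructor
  · intro h
    exact P.value_eq (by simpa using h)
  · intro h
    simpa [h] using hP.sub_value_mem hf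

theorem mem_ring_of_mem_riemannRochSpace (h : P.IsDiscrete) {A : Divisor k F} (hA : A P = 0)
    {f : F} (hf : f ∈ riemannRochSpace A) : f ∈ P.ring := by
  by_cases hf0 : f = 0
  · rw [hf0]; exact P.ring.zero_mem
  · rw [← h.ord_nonneg_iff hf0]
    simpa [hA] using hf.resolve_left hf0 P

theorem add_mem_riemannRochSpace (h : ∀ P : Place k F, P.IsDiscrete) {A : Divisor k F} {f g : F}
    (hf : f ∈ riemannRochSpace A) (hg : g ∈ riemannRochSpace A) :
    f + g ∈ riemannRochSpace A := by
  by_cases hf0 : f = 0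
  · rwa [hf0, zero_add]
  by_cases hg0 : g = 0
  · rwa [hg0, add_zero]
  by_cases hfg : f + g = 0
  · exact Or.inl hfg
  refine Or.inr fun P => ?_
  have h1 := hf.resolve_left hf0 P
  have h2 := hg.resolve_left hg0 P
  have := (h P).le_ord_add hf0 hg0 hfg (m := -A P) (by omega) (by omega)
  omega

theorem algebraMap_mul_mem_riemannRochSpace (h : ∀ P : Place k F, P.IsDiscrete)
    {A : Divisor k F} (a : k) {f : F} (hf : f ∈ riemannRochSpace A) :
    algebraMap k F a * f ∈ riemannRochSpace A := by
  by_cases ha : a = 0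
  · left; rw [ha, map_zero, zero_mul]
  by_cases hf0 : f = 0
  · left; rw [hf0, mul_zero]
  refine Or.inr fun P => ?_
  rw [(h P).ord_mul (by simpa using ha) hf0, (h P).ord_algebraMap ha, zero_add]
  exact hf.resolve_left hf0 P

/-- An algebraic geometry code is a linear code. -/
theorem exists_submodule_eq_code (h : ∀ P : Place k F, P.IsDiscrete) {n : ℕ}
    {D : Fin n → Place k F} (hD : ∀ i, (D i).IsRational) {A : Divisor k F}
    (hA : ∀ i, A (D i) = 0) : ∃ W : Submodule k (Fin n → k), (W : Set (Fin n → k)) = code D A :=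
  ⟨{  carrier := code D A
      zero_mem' := ⟨0, Or.inl rfl, funext fun i => by
        change (D i).value 0 = 0
        simpa using (D i).value_algebraMap 0⟩
      add_mem' := by
        rintro _ _ ⟨f, hf, rfl⟩ ⟨g, hg, rfl⟩
        exact ⟨f + g, add_mem_riemannRochSpace h hf hg, funext fun i =>
          (hD i).value_add (mem_ring_of_mem_riemannRochSpace (h _) (hA i) hf)
            (mem_ring_of_mem_riemannRochSpace (h _) (hA i) hg)⟩
      smul_mem' := by
        rintro a _ ⟨f, hf, rfl⟩
        refine ⟨_, algebraMap_mul_mem_riemannRochSpace h a hf, funext fun i => ?_⟩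
        change (D i).value (algebraMap k F a * f) = a * (D i).value f
        rw [(hD i).value_mul ((D i).algebraMap_mem a)
          (mem_ring_of_mem_riemannRochSpace (h _) (hA i) hf), Place.value_algebraMap] }, rfl⟩

/-- A nondegenerate linear code whose length is less than the cardinality of the field has a
codeword without zero coordinates. -/
theorem exists_mem_forall_ne_zero {K : Type*} [Field K] [Finite K] {n : ℕ} (hn : n < Nat.card K)
    (W : Submodule K (Fin n → K)) (hW : ∀ i, ∃ c ∈ W, c i ≠ 0) : ∃ c ∈ W, ∀ i, c i ≠ 0 := by
  classical
  have := Fintype.ofFinite K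
  suffices H : ∀ s : Finset (Fin n), ∃ c ∈ W, ∀ i ∈ s, c i ≠ 0 by
    obtain ⟨c, hc, hc'⟩ := H Finset.univ
    exact ⟨c, hc, fun i => hc' i (Finset.mem_univ i)⟩
  intro s
  induction s using Finset.induction_on with
  | empty => exact ⟨0, W.zero_mem, by simp⟩
  | insert i s hi ih =>
    obtain ⟨c, hc, hcs⟩ := ih
    obtain ⟨d, hd, hdi⟩ := hW i
    -- At most `n` scalars `a` create a zero of `c + a • d` at a coordinate where `d` is nonzero.
    obtain ⟨a, ha⟩ : ∃ a, a ∉ Finset.univ.image fun j => -c j / d j := by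
      by_contra! hall
      have h1 : (Finset.univ : Finset K).card ≤ (Finset.univ.image fun j => -c j / d j).card :=
        Finset.card_le_card fun a _ => hall a
      have h2 := h1.trans Finset.card_image_le
      rw [Finset.card_univ, Finset.card_univ, Fintype.card_fin, ← Nat.card_eq_fintype_card] at h2
      omega
    refine ⟨c + a • d, W.add_mem hc (W.smul_mem a hd), fun j hj h0 => ?_⟩
    have h0' : c j + a * d j = 0 := h0
    by_cases hdj : d j = 0
    · rcases Finset.mem_insert.1 hj with rfl | hj
      · exact hdi hdj
      · exact hcs j hj (by simpa [hdj] using h0')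
    · refine ha (Finset.mem_image.2 ⟨j, Finset.mem_univ j, ?_⟩)
      rw [div_eq_iff hdj]
      linear_combination -h0'

/-- If `f ∈ L(A)` has no zero at the rational places `D i`, then replacing `A` by the equivalent
effective divisor `A + (f)` multiplies the code by the column multipliers `f(D i)⁻¹`. -/
theorem exists_effective_of_forall_value_ne_zero [Finite k] (hF : IsFunctionFieldLE k F) {n : ℕ}
    {D : Fin n → Place k F} (hD : ∀ i, (D i).IsRational) {A : Divisor k F}
    (hA : ∀ i, A (D i) = 0) {f : F} (hf0 : f ≠ 0) (hf : f ∈ riemannRochSpace A)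
    (hval : ∀ i, (D i).value f ≠ 0) :
    ∃ A' : Divisor k F, 0 ≤ A' ∧ A'.degree = A.degree ∧ (∀ i, D i ∉ A'.support) ∧
      IsMonomiallyEquivalent (code D A) (code D A') := by
  have h := hF.isDiscrete
  obtain ⟨B, hB, hBdeg⟩ := hF.exists_principal_divisor hf0
  have hfmem : ∀ i, f ∈ (D i).ring := fun i => mem_ring_of_mem_riemannRochSpace (h _) (hA i) hf
  have hord : ∀ i, (D i).ord f = 0 := by
    intro i
    have h1 := ((h (D i)).ord_nonneg_iff hf0).2 (hfmem i)
    have h2 : ¬ 0 < (D i).ord f := by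
      rw [(h (D i)).ord_pos_iff hf0, (hD i).mem_nonunits_iff_value_eq_zero (hfmem i)]
      exact hval i
    omega
  have hA' : ∀ i, (A + B) (D i) = 0 := fun i => by
    rw [Finsupp.add_apply, hA, hB, hord, add_zero]
  have hmul : ∀ g, g ∈ riemannRochSpace (A + B) ↔ g * f ∈ riemannRochSpace A := by
    intro g
    by_cases hg0 : g = 0
    · rw [hg0, zero_mul]
      exact ⟨fun _ => Or.inl rfl, fun _ => Or.inl rfl⟩
    · refine or_congr (by simp [hf0]) (forall_congr' fun P => ?_)
      rw [(h P).ord_mul hg0 hf0, Finsupp.add_apply, hB]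
      constructor <;> intro <;> omega
  have heval : ∀ g ∈ riemannRochSpace (A + B), ∀ i,
      (D i).value (g * f) = (D i).value g * (D i).value f := fun g hg i =>
    (hD i).value_mul (mem_ring_of_mem_riemannRochSpace (h _) (hA' i) hg) (hfmem i)
  refine ⟨A + B, fun P => ?_, ?_, fun i => ?_, fun i => (Units.mk0 _ (hval i))⁻¹, ?_⟩
  · rw [Finsupp.add_apply, hB, add_comm]
    exact hf.resolve_left hf0 P
  · rw [Divisor.degree_add, hBdeg, add_zero]
  · rw [Finsupp.notMem_support_iff, hA']
  · ext c
    constructor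
    · rintro ⟨g, hg, rfl⟩
      refine ⟨_, ⟨g * f, (hmul g).1 hg, rfl⟩, funext fun i => ?_⟩
      change _ * (D i).value (g * f) = (D i).value g
      rw [heval g hg, Units.val_inv_eq_inv_val, Units.val_mk0]
      have := hval i
      field_simp
    · rintro ⟨_, ⟨g, hg, rfl⟩, rfl⟩
      have hgf : g / f * f = g := div_mul_cancel₀ g hf0
      have hg' : g / f ∈ riemannRochSpace (A + B) := (hmul _).2 (by rwa [hgf])
      refine ⟨g / f, hg', funext fun i => ?_⟩
      have h1 := heval _ hg' i
      rw [hgf] at h1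
      change (D i).value (g / f) = _ * (D i).value g
      rw [h1, Units.val_inv_eq_inv_val, Units.val_mk0]
      have := hval i
      field_simp

end Evaluation

theorem lt_pow_of_one_add_ceil_logb_le {q n e : ℕ} (hq : 1 < q) (hn : 1 ≤ n)
    (he : 1 + ⌈Real.logb q n⌉ ≤ (e : ℤ)) : n < q ^ e := by
  have h1 : Real.logb q n < e := by
    have h2 := Int.le_ceil (Real.logb q n)
    have h3 : (1 : ℝ) + (⌈Real.logb q n⌉ : ℝ) ≤ e := by exact_mod_cast he
    linarith
  rw [Real.logb_lt_iff_lt_rpow (by exact_mod_cast hq) (by exact_mod_cast hn),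
    Real.rpow_natCast] at h1
  exact_mod_cast h1

section Lift

variable {k F k' F' : Type*} [Field k] [Field F] [Field k'] [Field F'] [Algebra k F]
  [Algebra F F'] [Algebra k' F'] [Algebra k k'] [Algebra k F'] [IsScalarTower k F F']
  [IsScalarTower k k' F']

theorem algebraMap_mem_riemannRochSpace_conorm [Algebra.IsAlgebraic F F']
    (h : ∀ P : Place k F, P.IsDiscrete) (h' : ∀ P : Place k' F', P.IsDiscrete)
    (hfin : ∀ P : Place k F, ∃ s : Finset (Place k' F'), ∀ P', P' ∈ s ↔ P'.LiesOver P)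
    {A : Divisor k F} {f : F} (hf : f ∈ riemannRochSpace A) :
    algebraMap F F' f ∈ riemannRochSpace (conorm k' F' A) := by
  by_cases hf0 : f = 0
  · left; rw [hf0, map_zero]
  refine Or.inr fun P' => ?_
  obtain ⟨P, hP⟩ := Place.exists_liesOver (k := k) (F := F) P'
  rw [conorm_apply hP hfin, (hP.ramificationIndex_spec (h P) (h' P')).2 f hf0, ← mul_add]
  exact mul_nonneg (by positivity) (hf.resolve_left hf0 P)

theorem Place.LiesOver.value_algebraMap {P : Place k F} {P' : Place k' F'} (H : P'.LiesOver P)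
    (hP : P.IsRational) {f : F} (hf : f ∈ P.ring) :
    P'.value (algebraMap F F' f) = algebraMap k k' (P.value f) := by
  refine P'.value_eq ?_
  rw [← IsScalarTower.algebraMap_apply, IsScalarTower.algebraMap_apply k F F', ← map_sub]
  have hm := hP.sub_value_mem hf
  rw [ValuationSubring.mem_nonunits_iff_or] at hm ⊢
  refine hm.imp (fun h => by rw [h, map_zero]) fun h h1 => h ?_
  rw [← H, ValuationSubring.mem_comap, map_inv₀]
  exact h1

end Lift

end AGCode

end

theorem mainTheorem11
    -- `F` is a function field with full constant field `k`, the finite field with `q` elements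
    {k : Type*} [Field k] [Finite k]
    {F : Type*} [Field F] [Algebra k F] [Algebra (RatFunc k) F] [IsScalarTower k (RatFunc k) F]
    [FunctionField k F]
    (hfull : ∀ x : F, IsAlgebraic k x → x ∈ Set.range (algebraMap k F))
    -- `k'` is the extension of `k` of degree `e`, and `F'` is the compositum of `F` and `k'`
    {k' : Type*} [Field k'] [Algebra k k']
    {F' : Type*} [Field F'] [Algebra k F'] [Algebra F F'] [Algebra k' F']
    [IsScalarTower k F F'] [IsScalarTower k k' F']
    (hF' : IntermediateField.adjoin F (Set.range (algebraMap k' F')) = ⊤)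
    (e : ℕ) (hk' : Module.finrank k k' = e)
    -- `D` is the sum of `n` distinct rational places, disjoint from the support of `G`
    (n : ℕ) (hn : 1 ≤ n)
    (D : Fin n → AGCode.Place k F) (hD : Function.Injective D) (hrat : ∀ i, (D i).IsRational)
    (G : AGCode.Divisor k F) (hG : ∀ i, D i ∉ G.support)
    (he : 1 + ⌈Real.logb (Nat.card k : ℝ) (n : ℝ)⌉ ≤ (e : ℤ)) :
    -- `Con(P_i)` is a single rational place `D' i`
    ∃ D' : Fin n → AGCode.Place k' F',
      (∀ i, AGCode.conormPlace k' F' (D i) = Finsupp.single (D' i) 1) ∧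
      Function.Injective D' ∧ (∀ i, (D' i).IsRational) ∧
      (∀ i, D' i ∉ (AGCode.conorm k' F' G).support) ∧
      (AGCode.IsDegenerate (AGCode.code D G) ∨
        ∃ G' : AGCode.Divisor k' F',
          0 ≤ G' ∧ G'.degree = G.degree ∧ (∀ i, D' i ∉ G'.support) ∧
          AGCode.IsMonomiallyEquivalent
            (AGCode.code D' (AGCode.conorm k' F' G)) (AGCode.code D' G')) := by
  have hpos : 0 < Module.finrank k k' := by
    have h1 : (0 : ℝ) ≤ Real.logb (Nat.card k : ℝ) (n : ℝ) :=
      Real.logb_nonneg (by exact_mod_cast Finite.one_lt_card) (by exact_mod_cast hn)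
    have h2 := Int.ceil_nonneg h1
    omega
  have : FiniteDimensional k k' := Module.finite_of_finrank_pos hpos
  have : Finite k' := Module.finite_of_finite k
  obtain ⟨_, _, hrank⟩ := AGCode.isSeparable_and_finrank_of_adjoin_eq_top hfull hF'
  have hFF := AGCode.IsFunctionFieldLE.of_functionField k F
  have hFF' : AGCode.IsFunctionFieldLE k' F' :=
    (hFF.of_finite (F' := F')).extendScalars (k' := k')
  have hd := hFF.isDiscrete
  have hd' := hFF'.isDiscrete
  choose s hs hsum using AGCode.exists_finset_liesOver (k' := k') (F' := F') hrank hFF hFF'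
  have hfin : ∀ P : AGCode.Place k F, ∃ s : Finset (AGCode.Place k' F'),
      ∀ P', P' ∈ s ↔ P'.LiesOver P := fun P => ⟨s P, hs P⟩
  choose D' hD' hover hrat' using fun i =>
    AGCode.exists_conormPlace_eq_single (hrat i) (hs (D i))
      (fun P' hP' => (((hs _ P').1 hP').ramificationIndex_spec (hd _) (hd' _)).1)
      (fun P' => (hFF'.isDiscrete_and_degree_pos P').2) (hsum (D i))
  have hG' : ∀ i, AGCode.conorm k' F' G (D' i) = 0 := fun i => by
    rw [AGCode.conorm_apply (hover i) hfin, Finsupp.notMem_support_iff.1 (hG i), mul_zero]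
  refine ⟨D', hD', fun i j hij => hD ?_, hrat', fun i => ?_, ?_⟩
  · refine AGCode.Place.ext ?_
    rw [← hover i, ← hover j, hij]
  · rw [Finsupp.notMem_support_iff, hG']
  refine or_iff_not_imp_left.2 fun hdeg => ?_
  simp only [AGCode.IsDegenerate, not_exists, not_forall] at hdeg
  obtain ⟨W, hW⟩ := AGCode.exists_submodule_eq_code hd' hrat' hG'
  have hcard : n < Nat.card k' := by
    rw [Module.natCard_eq_pow_finrank (K := k), hk']
    exact AGCode.lt_pow_of_one_add_ceil_logb_le Finite.one_lt_card hn he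
  obtain ⟨c, hc, hc0⟩ := AGCode.exists_mem_forall_ne_zero hcard W fun i => by
    obtain ⟨c, ⟨f, hf, rfl⟩, hfi⟩ := hdeg i
    have hfmem : f ∈ (D i).ring := AGCode.mem_ring_of_mem_riemannRochSpace (hd _)
      (Finsupp.notMem_support_iff.1 (hG i)) hf
    refine ⟨AGCode.evalAt D' (algebraMap F F' f), ?_, ?_⟩
    · rw [← SetLike.mem_coe, hW]
      exact ⟨_, AGCode.algebraMap_mem_riemannRochSpace_conorm hd hd' hfin hf, rfl⟩
    · change (D' i).value (algebraMap F F' f) ≠ 0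
      rw [(hover i).value_algebraMap (hrat i) hfmem]
      change ¬ (D i).value f = 0 at hfi
      simpa using hfi
  rw [← SetLike.mem_coe, hW] at hc
  obtain ⟨f, hf, rfl⟩ := hc
  have hf0 : f ≠ 0 := by
    rintro rfl
    refine hc0 ⟨0, hn⟩ ?_
    change (D' ⟨0, hn⟩).value 0 = 0
    simpa using (D' ⟨0, hn⟩).value_algebraMap 0
  obtain ⟨G', h1, h2, h3, h4⟩ :=
    AGCode.exists_effective_of_forall_value_ne_zero hFF' hrat' hG' hf0 hf hc0
  refine ⟨G', h1, h2.trans (AGCode.degree_conorm (fun P => ?_) G), h3, h4⟩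
  rw [AGCode.degree_conormPlace (hs P), hsum P]
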